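/- Let $M$ be a (Hausdorff) complex manifold of complex dimension $n$ with complex structure $J$, equipped with a holomorphic action of $\mathbb{C}^\times$. Let $\xi_M$ be the vector field on $M$ induced by the restricted action of $\mathbb{R}/2\pi\mathbb{Z}\cong S^1\subset\mathbb{C}^\times$, and let $M^{S^1}$ be the set of points fixed by $S^1$. Let $\omega$ be an $S^1$-invariant symplectic form on (the real manifold underlying) $M$ that is tamed by the action, i.e. $\omega(\xi_M,J\xi_M)>0$ at every point of $M\smallsetminus M^{S^1}$, and let $\Psi\colon M\to\mathbb{R}$ be a moment map, i.e. a smooth function with $\iota_{\xi_M}\omega=-d\Psi$. Let $k\ge 1$ and let $p_1,\dots,p_k$ be distinct points of $M^{S^1}\cap\Psi^{-1}(0)$. Then there exist holomorphic linear actions of $\mathbb{C}^\times$ on $\mathbb{C}^n$, one for each $j=1,\dots,k$; a $\mathbb{C}^\times$-invariant open neighbourhood $U$ of $\{p_1,\dots,p_k\}$ in $M$; an open neighbourhood $W$ of $\coprod_{j=1}^k\{0\}$ in $\coprod_{j=1}^k\mathbb{C}^n$, invariant under the $\mathbb{C}^\times$-action given by the $j$-th linear action on the $j$-th copy of $\mathbb{C}^n$;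 and a $\mathbb{C}^\times$-equivariant biholomorphism $U\to W$ that sends $p_j$ to the origin of the $j$-th copy of $\mathbb{C}^n$ for each $j$. -/

import Mathlib

open scoped Manifold ContDiff

noncomputable section

namespace TameCircle

/-- The complex vector space `ℂⁿ`, with its Euclidean norm; it also carries the structure of a real
normed space, so that `𝓘(ℂ, Cn n)` is the model of complex `n`-dimensional manifolds and
`𝓘(ℝ, Cn n)` the model of the underlying real `2n`-dimensional manifolds. -/
abbrev Cn (n : ℕ) : Type := EuclideanSpace ℂ (Fin n)

section Manifold

variable {n : ℕ} {M : Type*} [TopologicalSpace M] [ChartedSpace (Cn n) M]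

/-- The complex structure `J` on the (real) tangent space at `x`: multiplication by `i`. -/
def J (x : M) (v : TangentSpace 𝓘(ℝ, Cn n) x) : TangentSpace 𝓘(ℝ, Cn n) x :=
  (Complex.I • (show Cn n from v) : Cn n)

variable (n M) in
/-- A field of real-valued alternating `2`-forms on the real tangent spaces of `M`
(no regularity imposed). -/
abbrev TwoForm : Type _ := ∀ x : M, TangentSpace 𝓘(ℝ, Cn n) x [⋀^Fin 2]→L[ℝ] ℝ

/-- The `2`-form `Ω` read in the chart `e`: the pullback of `Ω` under `e⁻¹`, as a `2`-form on
`e.target ⊆ ℂⁿ` (the values outside `e.target` are irrelevant). -/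
def TwoForm.inChart (Ω : TwoForm n M) (e : OpenPartialHomeomorph M (Cn n)) (y : Cn n) :
    Cn n [⋀^Fin 2]→L[ℝ] ℝ :=
  (Ω (e.symm y)).compContinuousLinearMap (mfderiv 𝓘(ℝ, Cn n) 𝓘(ℝ, Cn n) e.symm y)

/-- A symplectic form: a smooth, closed, non-degenerate `2`-form. -/
structure TwoForm.IsSymplectic (Ω : TwoForm n M) : Prop where
  smooth : ∀ e ∈ atlas (Cn n) M, ContDiffOn ℝ ∞ (Ω.inChart e) e.target
  closed : ∀ e ∈ atlas (Cn n) M, ∀ y ∈ e.target, extDeriv (Ω.inChart e) y = 0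
  nondegenerate : ∀ (x : M) (v : TangentSpace 𝓘(ℝ, Cn n) x), (∀ w, Ω x ![v, w] = 0) → v = 0

end Manifold

section Action

variable {n : ℕ} {M : Type*} [TopologicalSpace M] [ChartedSpace (Cn n) M] [MulAction ℂˣ M]

variable (M) in
/-- The set of points of `M` fixed by the circle `S¹ ⊂ ℂˣ`. -/
def circleFixedPoints : Set M := {x | ∀ z : Circle, Circle.toUnits z • x = x}

/-- The vector field on `M` induced by the action of `ℝ/2πℤ ≅ S¹ ⊂ ℂˣ`, i.e. the velocity at
`θ = 0` of the curve `θ ↦ e^{iθ} • x`. -/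
def circleField (x : M) : TangentSpace 𝓘(ℝ, Cn n) x :=
  (mfderiv 𝓘(ℝ, ℝ) 𝓘(ℝ, Cn n) (fun θ : ℝ => Circle.toUnits (Circle.exp θ) • x) 0 (1 : ℝ) : Cn n)

/-- The `2`-form `Ω` is `S¹`-invariant: every element of `S¹` acts by a map which pulls `Ω` back
to itself. -/
def TwoForm.IsCircleInvariant (Ω : TwoForm n M) : Prop :=
  ∀ (z : Circle) (x : M),
    (Ω (Circle.toUnits z • x)).compContinuousLinearMap
      (mfderiv 𝓘(ℝ, Cn n) 𝓘(ℝ, Cn n) (fun y : M => Circle.toUnits z • y) x) = Ω x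

/-- The action tames `Ω`: `Ω(ξ, J ξ) > 0` away from the `S¹`-fixed points, where `ξ` is the vector
field induced by the circle action. -/
def TwoForm.IsTamedByAction (Ω : TwoForm n M) : Prop :=
  ∀ x : M, x ∉ circleFixedPoints M → 0 < Ω x ![circleField x, J x (circleField x)]

/-- `Ψ` is a moment map for the circle action: it is smooth and `ι_ξ Ω = -dΨ`. -/
structure TwoForm.IsMomentMap (Ω : TwoForm n M) (Ψ : M → ℝ) : Prop where
  smooth : ContMDiff 𝓘(ℝ, Cn n) 𝓘(ℝ, ℝ) ∞ Ψ
  contract_eq : ∀ (x : M) (v : TangentSpace 𝓘(ℝ, Cn n) x),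
    Ω x ![circleField x, v] = -(mfderiv 𝓘(ℝ, Cn n) 𝓘(ℝ, ℝ) Ψ x v : ℝ)

end Action

section DisjointUnion

/-- The disjoint union of `k` copies of `ℂⁿ`. -/
abbrev Copies (k n : ℕ) : Type := Σ _ : Fin k, Cn n

/-- The inverse of the inclusion of the `j`-th copy of `ℂⁿ`, as a chart. -/
def Copies.chart {k : ℕ} (n : ℕ) (j : Fin k) : OpenPartialHomeomorph (Copies k n) (Cn n) :=
  ((Topology.IsOpenEmbedding.sigmaMk (σ := fun _ : Fin k => Cn n)
    (i := j)).toOpenPartialHomeomorph _).symm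

instance (k n : ℕ) : ChartedSpace (Cn n) (Copies k n) where
  atlas := Set.range (Copies.chart n)
  chartAt q := Copies.chart n q.1
  mem_chart_source q := by
    simp only [Copies.chart, OpenPartialHomeomorph.symm_source,
      Topology.IsOpenEmbedding.toOpenPartialHomeomorph_target]
    exact ⟨q.2, rfl⟩
  chart_mem_atlas q := ⟨q.1, rfl⟩

/-- The disjoint union of `k` copies of `ℂⁿ` is a complex manifold. -/
instance (k n : ℕ) : IsManifold 𝓘(ℂ, Cn n) ω (Copies k n) := by
  apply isManifold_of_contDiffOn
  rintro e e' ⟨i, rfl⟩ ⟨j, rfl⟩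
  by_cases h : i = j
  · subst h
    refine contDiff_id.contDiffOn.congr ?_
    intro y _
    change Copies.chart n i ((Copies.chart n i).symm y) = y
    exact (Copies.chart n i).right_inv (by simp [Copies.chart])
  · intro y hy
    exfalso
    have h2 : (Copies.chart n i).symm y ∈ (Copies.chart n j).source := by
      have := hy.1
      simp at this
      exact this.2
    simp only [Copies.chart, OpenPartialHomeomorph.symm_source,
      Topology.IsOpenEmbedding.toOpenPartialHomeomorph_target] at h2
    obtain ⟨w, hw⟩ := h2
    exact h (congrArg Sigma.fst hw).symm

end DisjointUnion

/-- A linear action of `ℂˣ` on `ℂⁿ` is holomorphic if `(c, v) ↦ c • v` is. -/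
def IsHolomorphicLinearAction {n : ℕ} (ρ : Representation ℂ ℂˣ (Cn n)) : Prop :=
  ContMDiff (𝓘(ℂ, ℂ).prod 𝓘(ℂ, Cn n)) 𝓘(ℂ, Cn n) ω (fun q : ℂˣ × Cn n => ρ q.1 q.2)

/-- A biholomorphism between open subsets of two complex manifolds: a homeomorphism `Φ` from
the open set `Φ.source` onto the open set `Φ.target` which is holomorphic in both directions. -/
structure IsBiholomorphism {n : ℕ} {M N : Type*} [TopologicalSpace M] [ChartedSpace (Cn n) M]
    [TopologicalSpace N] [ChartedSpace (Cn n) N] (Φ : OpenPartialHomeomorph M N) : Prop where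
  holomorphic : ContMDiffOn 𝓘(ℂ, Cn n) 𝓘(ℂ, Cn n) ω Φ Φ.source
  holomorphic_symm : ContMDiffOn 𝓘(ℂ, Cn n) 𝓘(ℂ, Cn n) ω Φ.symm Φ.target

end TameCircle

end

/-!
The action of `ℂˣ` is first linearized near each `p j` as an action of the circle: averaging a chart
over the circle against the isotropy representation gives a holomorphic chart that intertwines the
two actions of the circle (`exists_linearizingChart`). The average is holomorphic since integrals of
analytic families are analytic (`analyticAt_intervalIntegral`). By the identity theorem, the inverse
of this chart also intertwines the actions of positive real numbers, for as long as the linear orbit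
stays in a fixed ball (`LinearizingChart.expUnit_smul_symm`). To extend the chart to the union of
the `ℂˣ`-orbits, one has to know that an orbit which leaves the ball never returns close to any of
the `p j`.

In the linear model this is the maximum principle for an invariant norm
(`PeriodicFlow.circleNorm_apply_le_max`). In `M` it is the only point where the symplectic form
enters: the velocity of the orbit of the positive reals is `-J ξ`, so that, by tameness, the moment
map `Ψ` increases along it (`strictMono_momentMap`). Orbits that start close to `p j` leave the ball
near the set of those points of the sphere that flow back to `p j`, where `Ψ` is positive because
`Ψ (p j) = 0`; by compactness `Ψ` is bounded below by a positive constant at the exit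
(`PeriodicFlow.exists_lt_at_exit`). Since `Ψ` is close to `0` near all the `p i`, and only
increases, the orbit does not come back. Going in the other direction exchanges start and end of the
orbit.

Hence, on small balls, two points lie on one orbit in `M` through a given element of `ℂˣ` exactly
when they do so in the linear models (`exists_smul_symm_eq_iff`), and then the charts extend
equivariantly (`exists_equivariant_biholomorphism`).
-/

noncomputable section

namespace TameCircle

open Filter Topology Set MeasureTheory
open scoped NNReal ENNReal Real

/-! ### Integrals of analytic families -/

section ParametricIntegral

variable {G E F : Type*} [NormedAddCommGroup G] [NormedSpace ℂ G]
  [NormedAddCommGroup E] [NormedSpace ℂ E] [NormedAddCommGroup F] [NormedSpace ℂ F]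

/-- The local case of `analyticAt_intervalIntegral`: the path stays in a small ball around `g₀`.
The expansion of `f` at `(g₀, y₀)` is recentred at each `(γ θ, y₀)`, and the coefficients of the
recentred series are integrated one by one. -/
theorem exists_analyticAt_intervalIntegral_of_dist_lt [CompleteSpace F] {f : G → E → F} {γ : ℝ → G}
    (hγ : Continuous γ) {g₀ : G} {y₀ : E} (hf : AnalyticAt ℂ (Function.uncurry f) (g₀, y₀)) :
    ∃ δ > 0, ∀ a b : ℝ, (∀ θ ∈ uIcc a b, dist (γ θ) g₀ < δ) →
      AnalyticAt ℂ (fun y => ∫ θ in a..b, f (γ θ) y) y₀ := by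
  obtain ⟨p, r, hp⟩ := hf
  obtain ⟨ρ, hρ0, hρ⟩ : ∃ ρ : ℝ≥0, 0 < ρ ∧ (ρ + ρ : ℝ≥0∞) < r := by
    obtain ⟨s, hs0, hs⟩ := ENNReal.lt_iff_exists_nnreal_btwn.1 hp.r_pos
    have hs0 : 0 < s := by exact_mod_cast hs0
    refine ⟨s / 2, by positivity, ?_⟩
    rwa [← ENNReal.coe_add, add_halves]
  have hρp : (ρ + ρ : ℝ≥0∞) < p.radius := hρ.trans_le hp.r_le
  refine ⟨ρ, by exact_mod_cast hρ0, fun a b hab => ?_⟩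
  set x : ℝ → G × E := fun θ => (γ θ - g₀, 0) with hx
  have hxc : Continuous x := by fun_prop
  have hxn : ∀ θ ∈ uIcc a b, ‖x θ‖₊ < ρ := by
    intro θ hθ
    have := hab θ hθ
    rw [dist_eq_norm] at this
    rw [← NNReal.coe_lt_coe, coe_nnnorm]
    simpa [hx, Prod.norm_def] using this
  set q : ℝ → FormalMultilinearSeries ℂ E F := fun θ k =>
    (p.changeOrigin (x θ) k).compContinuousLinearMap
      (fun _ => ContinuousLinearMap.inr ℂ G E) with hq
  -- the coefficients of the expansions at the points `(γ θ, y₀)` are bounded uniformly in `θ`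
  set C : ℕ → ℝ≥0 := fun k =>
    ∑' s : Σ l : ℕ, { s : Finset (Fin (k + l)) // s.card = l }, ‖p (k + s.1)‖₊ * ρ ^ s.1 with hC
  have hsum := p.changeOriginSeries_summable_aux₁ hρp
  have hCsum : Summable fun k => C k * ρ ^ k := by
    have := (NNReal.summable_sigma.1 hsum).2
    simpa only [hC, ← NNReal.tsum_mul_right] using this
  have hρlt : (ρ : ℝ≥0∞) < p.radius := lt_of_le_of_lt le_self_add hρp
  have hqC : ∀ θ ∈ uIcc a b, ∀ k, ‖q θ k‖ ≤ C k := by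
    intro θ hθ k
    have h1 : ((‖x θ‖₊ : ℝ≥0) : ℝ≥0∞) < p.radius :=
      lt_trans (by exact_mod_cast hxn θ hθ) hρlt
    have h2 := p.nnnorm_changeOrigin_le k h1
    have h3 : ‖p.changeOrigin (x θ) k‖₊ ≤ C k := by
      refine h2.trans ?_
      refine Summable.tsum_le_tsum (fun s => ?_) (p.changeOriginSeries_summable_aux₂ h1 k)
        (p.changeOriginSeries_summable_aux₂ hρlt k)
      gcongr
      exact (hxn θ hθ).le
    refine (ContinuousMultilinearMap.norm_compContinuousLinearMap_le _ _).trans ?_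
    calc ‖p.changeOrigin (x θ) k‖ * ∏ _i : Fin k, ‖ContinuousLinearMap.inr ℂ G E‖
        ≤ ‖p.changeOrigin (x θ) k‖ * 1 := by
          gcongr
          exact Finset.prod_le_one (fun _ _ => norm_nonneg _)
            (fun _ _ => ContinuousLinearMap.norm_inr_le_one ℂ G E)
      _ ≤ C k := by rw [mul_one]; exact_mod_cast h3
  have hqcont : ∀ k, ContinuousOn (fun θ => q θ k) (uIcc a b) := by
    intro k
    have h1 : ContinuousOn (fun θ => p.changeOrigin (x θ) k) (uIcc a b) := by
      refine (p.hasFPowerSeriesOnBall_changeOrigin k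
        (lt_of_le_of_lt (zero_le (a := (ρ : ℝ≥0∞))) hρlt)).continuousOn.comp hxc.continuousOn ?_
      intro θ hθ
      rw [mem_eball_zero_iff]
      exact lt_trans (by rw [enorm_eq_nnnorm]; exact_mod_cast hxn θ hθ) hρlt
    exact (ContinuousMultilinearMap.compContinuousLinearMapL
      (fun _ : Fin k => ContinuousLinearMap.inr ℂ G E)).continuous.comp_continuousOn h1
  have hqsum : ∀ θ ∈ uIcc a b, ∀ η : E, ‖η‖₊ < ρ →
      HasSum (fun k => q θ k fun _ => η) (f (γ θ) (y₀ + η)) := by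
    intro θ hθ η hη
    have h1 : ((‖x θ‖₊ : ℝ≥0) : ℝ≥0∞) < r :=
      lt_trans (by exact_mod_cast hxn θ hθ) (lt_of_le_of_lt le_self_add hρ)
    have h2 := hp.changeOrigin h1
    have h3 : ((0 : G), η) ∈ Metric.eball (0 : G × E) (r - ‖x θ‖₊) := by
      rw [mem_eball_zero_iff, lt_tsub_iff_right]
      refine lt_trans ?_ hρ
      rw [enorm_eq_nnnorm]
      refine ENNReal.add_lt_add ?_ (by exact_mod_cast hxn θ hθ)
      simpa [Prod.nnnorm_def] using hη
    have h4 := h2.hasSum h3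
    simpa [hx, hq, Function.uncurry, Function.comp_def] using h4
  set Q : FormalMultilinearSeries ℂ E F := fun k => ∫ θ in a..b, q θ k with hQ
  refine ⟨Q, ρ, ?_, by exact_mod_cast hρ0, ?_⟩
  · refine Q.le_radius_of_summable_norm ?_
    have h1 : Summable fun k => ((C k * ρ ^ k : ℝ≥0) : ℝ) * |b - a| :=
      (NNReal.summable_coe.2 hCsum).mul_right _
    refine Summable.of_nonneg_of_le (fun k => by positivity) (fun k => ?_) h1
    have h2 : ‖Q k‖ ≤ C k * |b - a| :=
      intervalIntegral.norm_integral_le_of_norm_le_const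
        fun θ hθ => hqC θ (uIoc_subset_uIcc hθ) k
    calc ‖Q k‖ * (ρ : ℝ) ^ k ≤ (C k * |b - a|) * (ρ : ℝ) ^ k := by gcongr
      _ = _ := by push_cast; ring
  · intro η hη
    rw [mem_eball_zero_iff, enorm_eq_nnnorm] at hη
    have hη : ‖η‖₊ < ρ := by exact_mod_cast hη
    have hQη : ∀ k, (Q k fun _ => η) = ∫ θ in a..b, q θ k fun _ => η := by
      intro k
      exact ((ContinuousMultilinearMap.apply ℂ (fun _ : Fin k => E) F
        (fun _ => η)).intervalIntegral_comp_comm (hqcont k).intervalIntegrable).symm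
    simp_rw [hQη]
    refine intervalIntegral.hasSum_integral_of_dominated_convergence
      (fun k _ => ((C k * ρ ^ k : ℝ≥0) : ℝ)) ?_ ?_ ?_ ?_ ?_
    · intro k
      refine ContinuousOn.aestronglyMeasurable ?_ measurableSet_uIoc
      exact ((ContinuousMultilinearMap.apply ℂ (fun _ : Fin k => E) F
        (fun _ => η)).continuous.comp_continuousOn (hqcont k)).mono uIoc_subset_uIcc
    · refine fun k => Eventually.of_forall fun θ hθ => ?_
      refine ((q θ k).le_opNorm _).trans ?_
      rw [Finset.prod_const, Finset.card_univ, Fintype.card_fin]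
      push_cast
      gcongr
      · exact hqC θ (uIoc_subset_uIcc hθ) k
      · exact_mod_cast hη.le
    · exact Eventually.of_forall fun θ _ => NNReal.summable_coe.2 hCsum
    · exact intervalIntegrable_const
    · exact Eventually.of_forall fun θ hθ => hqsum θ (uIoc_subset_uIcc hθ) η hη

theorem eventually_forall_analyticAt [CompleteSpace F] {f : G → E → F} {γ : ℝ → G}
    (hγ : Continuous γ) {y₀ : E} (hf : ∀ θ, AnalyticAt ℂ (Function.uncurry f) (γ θ, y₀))
    {K : Set ℝ} (hK : IsCompact K) :
    ∀ᶠ y in 𝓝 y₀, ∀ θ ∈ K, AnalyticAt ℂ (Function.uncurry f) (γ θ, y) := by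
  refine hK.eventually_forall_of_forall_eventually fun θ _ => ?_
  have : Tendsto (fun z : E × ℝ => (γ z.2, z.1)) (𝓝 (y₀, θ)) (𝓝 (γ θ, y₀)) :=
    Continuous.tendsto (f := fun z : E × ℝ => (γ z.2, z.1)) (by fun_prop) _
  exact this.eventually (hf θ).eventually_analyticAt

theorem continuousOn_of_forall_analyticAt {f : G → E → F} {γ : ℝ → G} (hγ : Continuous γ) {y : E}
    {K : Set ℝ} (hf : ∀ θ ∈ K, AnalyticAt ℂ (Function.uncurry f) (γ θ, y)) :
    ContinuousOn (fun θ => f (γ θ) y) K := by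
  intro θ hθ
  have h1 : ContinuousAt (fun θ => (γ θ, y)) θ := by fun_prop
  exact (ContinuousAt.comp (f := fun θ => (γ θ, y)) (hf θ hθ).continuousAt h1).continuousWithinAt

/-- The integral along a path of a jointly analytic family of functions is analytic. -/
theorem analyticAt_intervalIntegral [CompleteSpace F] {f : G → E → F} {γ : ℝ → G}
    (hγ : Continuous γ) {y₀ : E} (hf : ∀ θ, AnalyticAt ℂ (Function.uncurry f) (γ θ, y₀)) (a b : ℝ) :
    AnalyticAt ℂ (fun y => ∫ θ in a..b, f (γ θ) y) y₀ := by
  -- the set of good end points is open and closed: the local case passes between nearby points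
  set S : Set ℝ := {t | AnalyticAt ℂ (fun y => ∫ θ in a..t, f (γ θ) y) y₀} with hS
  have key : ∀ t₀, ∃ ε > 0, ∀ s ∈ Metric.ball t₀ ε, ∀ t ∈ Metric.ball t₀ ε, s ∈ S → t ∈ S := by
    intro t₀
    obtain ⟨δ, hδ, h⟩ := exists_analyticAt_intervalIntegral_of_dist_lt hγ (hf t₀)
    obtain ⟨ε, hε, h'⟩ := Metric.continuousAt_iff.1 hγ.continuousAt δ hδ
    refine ⟨ε, hε, fun s hs t ht hsS => ?_⟩
    have hst : ∀ θ ∈ uIcc s t, dist (γ θ) (γ t₀) < δ := by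
      intro θ hθ
      refine h' ?_
      have : uIcc s t ⊆ Metric.ball t₀ ε :=
        (convex_ball t₀ ε).ordConnected.uIcc_subset hs ht
      exact this hθ
    refine (hsS.add (h s t hst)).congr ?_
    filter_upwards [eventually_forall_analyticAt hγ hf (isCompact_uIcc (a := a) (b := s)),
      eventually_forall_analyticAt hγ hf (isCompact_uIcc (a := s) (b := t))] with y h1 h2
    exact intervalIntegral.integral_add_adjacent_intervals
      (continuousOn_of_forall_analyticAt hγ h1).intervalIntegrable
      (continuousOn_of_forall_analyticAt hγ h2).intervalIntegrable
  have hclopen : IsClopen S := by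
    constructor
    · rw [← isOpen_compl_iff, Metric.isOpen_iff]
      intro t₀ ht₀
      obtain ⟨ε, hε, h⟩ := key t₀
      exact ⟨ε, hε, fun s hs hsS => ht₀ (h s hs t₀ (Metric.mem_ball_self hε) hsS)⟩
    · rw [Metric.isOpen_iff]
      intro t₀ ht₀
      obtain ⟨ε, hε, h⟩ := key t₀
      exact ⟨ε, hε, fun s hs => h t₀ (Metric.mem_ball_self hε) s hs ht₀⟩
  have ha : a ∈ S := by
    simp only [hS, mem_ofPred_eq, intervalIntegral.integral_same]
    exact analyticAt_const
  have := hclopen.eq_univ ⟨a, ha⟩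
  exact (this ▸ mem_univ b : b ∈ S)

theorem hasFDerivAt_intervalIntegral [CompleteSpace F] {f : G → E → F} {γ : ℝ → G}
    (hγ : Continuous γ) {y₀ : E} (hf : ∀ θ, AnalyticAt ℂ (Function.uncurry f) (γ θ, y₀)) (a b : ℝ) :
    HasFDerivAt (fun y => ∫ θ in a..b, f (γ θ) y) (∫ θ in a..b, fderiv ℂ (f (γ θ)) y₀) y₀ := by
  have hdiff : ∀ θ y, AnalyticAt ℂ (Function.uncurry f) (γ θ, y) →
      HasFDerivAt (f (γ θ)) (fderiv ℂ (f (γ θ)) y) y := by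
    intro θ y h
    have h1 : AnalyticAt ℂ (fun y => Function.uncurry f (γ θ, y)) y :=
      AnalyticAt.comp (f := fun y => (γ θ, y)) h (by fun_prop)
    exact h1.differentiableAt.hasFDerivAt
  have hcont : ∀ θ, ContinuousAt (fun z : E × ℝ => fderiv ℂ (f (γ z.2)) z.1) (y₀, θ) := by
    intro θ
    have h1 : ContDiffAt ℂ ω (fun z : G × E => fderiv ℂ (f z.1) z.2) (γ θ, y₀) := by
      refine ContDiffAt.fderiv (f := fun z : G × E => f z.1) (g := Prod.snd) (n := ω) ?_
        contDiffAt_snd (by simp)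
      have h2 : ContDiffAt ℂ ω (Function.uncurry f) (γ θ, y₀) := (hf θ).contDiffAt
      exact ContDiffAt.comp ((γ θ, y₀), y₀) (g := Function.uncurry f)
        (f := fun w : (G × E) × E => (w.1.1, w.2)) h2 (by fun_prop)
    exact ContinuousAt.comp (f := fun z : E × ℝ => (γ z.2, z.1)) (x := (y₀, θ)) h1.continuousAt
      (by fun_prop)
  have hcont₀ : Continuous fun θ => fderiv ℂ (f (γ θ)) y₀ := by
    rw [continuous_iff_continuousAt]
    intro θ
    exact ContinuousAt.comp (f := fun θ : ℝ => (y₀, θ)) (hcont θ) (by fun_prop)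
  obtain ⟨C, hC⟩ := (isCompact_uIcc (a := a) (b := b)).exists_bound_of_continuousOn
    hcont₀.continuousOn
  have hbound : ∀ᶠ y in 𝓝 y₀, ∀ θ ∈ uIcc a b, ‖fderiv ℂ (f (γ θ)) y‖ < C + 1 := by
    refine isCompact_uIcc.eventually_forall_of_forall_eventually fun θ hθ => ?_
    exact (hcont θ).norm.eventually_lt_const (lt_of_le_of_lt (hC θ hθ) (by linarith))
  have han := eventually_forall_analyticAt hγ hf (isCompact_uIcc (a := a) (b := b))
  refine intervalIntegral.hasFDerivAt_integral_of_dominated_of_fderiv_le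
    (F := fun y θ => f (γ θ) y) (F' := fun y θ => fderiv ℂ (f (γ θ)) y) (bound := fun _ => C + 1)
    (Filter.inter_mem hbound han) ?_ ?_ ?_ ?_ ?_ ?_
  · filter_upwards [han] with y hy
    exact ((continuousOn_of_forall_analyticAt hγ hy).mono
      uIoc_subset_uIcc).aestronglyMeasurable measurableSet_uIoc
  · exact (continuousOn_of_forall_analyticAt hγ fun θ _ => hf θ).intervalIntegrable
  · exact hcont₀.aestronglyMeasurable
  · exact Eventually.of_forall fun θ hθ y hy => (hy.1 θ (uIoc_subset_uIcc hθ)).le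
  · exact intervalIntegrable_const
  · exact Eventually.of_forall fun θ hθ y hy => hdiff θ y (hy.2 θ (uIoc_subset_uIcc hθ))

end ParametricIntegral

/-! ### Periodic linear flows -/

open Complex in
/-- A holomorphic one-parameter group `ζ ↦ A ζ` of linear maps with period `2πi`. This is a
holomorphic linear action of `ℂˣ`, written in the variable `ζ` with `c = exp ζ`: the circle
acts through `ζ = iθ`, and real `ζ` give the complementary noncompact direction. -/
structure PeriodicFlow (E : Type*) [NormedAddCommGroup E] [NormedSpace ℂ E] where
  toFun : ℂ → E →L[ℂ] E
  map_zero : toFun 0 = 1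
  map_add : ∀ ζ ζ', toFun (ζ + ζ') = toFun ζ * toFun ζ'
  differentiable : Differentiable ℂ toFun
  periodic : toFun (2 * π * I) = 1

namespace PeriodicFlow

open Complex

section Basic

variable {E : Type*} [NormedAddCommGroup E] [NormedSpace ℂ E] (A : PeriodicFlow E)

instance : CoeFun (PeriodicFlow E) fun _ => ℂ → E →L[ℂ] E := ⟨toFun⟩

theorem zero_apply (v : E) : A 0 v = v := by rw [A.map_zero]; rfl

theorem add_apply (ζ ζ' : ℂ) (v : E) : A (ζ + ζ') v = A ζ (A ζ' v) := by rw [A.map_add]; rfl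

theorem neg_apply_apply (ζ : ℂ) (v : E) : A (-ζ) (A ζ v) = v := by
  rw [← A.add_apply, neg_add_cancel, A.zero_apply]

theorem apply_neg_apply (ζ : ℂ) (v : E) : A ζ (A (-ζ) v) = v := by
  rw [← A.add_apply, add_neg_cancel, A.zero_apply]

theorem apply_comm (ζ ζ' : ℂ) (v : E) : A ζ (A ζ' v) = A ζ' (A ζ v) := by
  rw [← A.add_apply, add_comm, A.add_apply]

theorem continuous : Continuous A := A.differentiable.continuous

theorem continuous_circle : Continuous fun θ : ℝ => A (θ * I) := A.continuous.comp (by fun_prop)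

theorem continuous_uncurry : Continuous fun z : ℂ × E => A z.1 z.2 :=
  (A.continuous.comp continuous_fst).clm_apply continuous_snd

theorem differentiable_apply (v : E) : Differentiable ℂ fun ζ => A ζ v :=
  A.differentiable.clm_apply (differentiable_const v)

theorem add_two_pi_mul_I (ζ : ℂ) : A (ζ + 2 * π * I) = A ζ := by
  rw [A.map_add, A.periodic, mul_one]

theorem add_int_mul_two_pi_I (ζ : ℂ) (k : ℤ) : A (ζ + k * (2 * π * I)) = A ζ :=
  (show Function.Periodic A (2 * π * I) from A.add_two_pi_mul_I).int_mul k ζ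

theorem eq_of_exp_eq {ζ ζ' : ℂ} (h : exp ζ = exp ζ') : A ζ = A ζ' := by
  obtain ⟨k, hk⟩ := exp_eq_exp_iff_exists_int.1 h
  rw [hk, A.add_int_mul_two_pi_I]

/-- The action of `ℂˣ` defined by a periodic flow. The branch of the logarithm does not matter, by
periodicity. -/
def toRepresentation : Representation ℂ ℂˣ E where
  toFun c := (A (log c)).toLinearMap
  map_one' := by
    rw [Units.val_one, log_one, A.map_zero]; rfl
  map_mul' c d := by
    rw [show A (log ↑(c * d)) = A (log c + log d) from A.eq_of_exp_eq (by
      rw [exp_add, exp_log c.ne_zero, exp_log d.ne_zero, exp_log (c * d).ne_zero, Units.val_mul]),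
      A.map_add]
    rfl

theorem toRepresentation_apply_of_exp_eq {c : ℂˣ} {ζ : ℂ} (h : exp ζ = c) (v : E) :
    A.toRepresentation c v = A ζ v := by
  change A (log c) v = A ζ v
  rw [A.eq_of_exp_eq (show exp (log c) = exp ζ by rw [exp_log c.ne_zero, h])]

/-- The circle-invariant norm `v ↦ sup_θ ‖A(iθ) v‖`. -/
def circleNorm (v : E) : ℝ := sSup ((fun θ : ℝ => ‖A (θ * I) v‖) '' Icc 0 (2 * π))

theorem continuous_norm_circle : Continuous fun z : E × ℝ => ‖A (z.2 * I) z.1‖ :=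
  (A.continuous_uncurry.comp (f := fun z : E × ℝ => ((z.2 : ℂ) * I, z.1)) (by fun_prop)).norm

theorem continuous_circleNorm : Continuous A.circleNorm :=
  isCompact_Icc.continuous_sSup A.continuous_norm_circle

theorem exists_mem_Icc_circle_eq (θ : ℝ) : ∃ θ' ∈ Icc 0 (2 * π), A (θ * I) = A ((θ' : ℝ) * I) := by
  obtain ⟨θ', hθ', h⟩ := Function.Periodic.exists_mem_Ico₀ (f := fun θ : ℝ => A (θ * I))
    (c := 2 * π) (fun θ => by
      beta_reduce
      rw [show ((θ + 2 * π : ℝ) : ℂ) * I = θ * I + 2 * π * I by push_cast; ring,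
        A.add_two_pi_mul_I]) Real.two_pi_pos θ
  exact ⟨θ', ⟨hθ'.1, hθ'.2.le⟩, h⟩

theorem isCompact_circle_image (v : E) :
    IsCompact ((fun θ : ℝ => ‖A (θ * I) v‖) '' Icc 0 (2 * π)) :=
  isCompact_Icc.image (A.continuous_norm_circle.comp (f := fun θ : ℝ => (v, θ)) (by fun_prop))

theorem norm_circle_apply_le (θ : ℝ) (v : E) : ‖A (θ * I) v‖ ≤ A.circleNorm v := by
  obtain ⟨θ', hθ', h⟩ := A.exists_mem_Icc_circle_eq θ
  rw [h]
  exact le_csSup (A.isCompact_circle_image v).bddAbove ⟨θ', hθ', rfl⟩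

theorem exists_norm_circle_apply_eq (v : E) : ∃ θ : ℝ, ‖A (θ * I) v‖ = A.circleNorm v := by
  obtain ⟨θ, _, h⟩ := (A.isCompact_circle_image v).sSup_mem
    ((nonempty_Icc.2 Real.two_pi_pos.le).image _)
  exact ⟨θ, h⟩

theorem norm_le_circleNorm (v : E) : ‖v‖ ≤ A.circleNorm v := by
  simpa [A.zero_apply] using A.norm_circle_apply_le 0 v

theorem circleNorm_nonneg (v : E) : 0 ≤ A.circleNorm v :=
  (norm_nonneg v).trans (A.norm_le_circleNorm v)

theorem circleNorm_zero : A.circleNorm 0 = 0 := by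
  obtain ⟨θ, h⟩ := A.exists_norm_circle_apply_eq 0
  rw [← h, _root_.map_zero, norm_zero]

theorem circleNorm_circle_apply (θ : ℝ) (v : E) : A.circleNorm (A (θ * I) v) = A.circleNorm v := by
  have key : ∀ (θ : ℝ) (v : E), A.circleNorm (A (θ * I) v) ≤ A.circleNorm v := by
    intro θ v
    obtain ⟨θ', h⟩ := A.exists_norm_circle_apply_eq (A (θ * I) v)
    rw [← h, ← A.add_apply, ← add_mul, ← ofReal_add]
    exact A.norm_circle_apply_le _ _
  refine le_antisymm (key θ v) ?_
  have := key (-θ) (A (θ * I) v)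
  rwa [← A.add_apply, ← add_mul, ← ofReal_add, neg_add_cancel, ofReal_zero, zero_mul,
    A.zero_apply] at this

theorem circleNorm_apply_eq_re (ζ : ℂ) (v : E) :
    A.circleNorm (A ζ v) = A.circleNorm (A ζ.re v) := by
  conv_lhs => rw [← re_add_im ζ, add_comm, A.add_apply]
  exact A.circleNorm_circle_apply _ _

theorem norm_apply_le_circleNorm_re (ζ : ℂ) (v : E) : ‖A ζ v‖ ≤ A.circleNorm (A ζ.re v) := by
  rw [← A.circleNorm_apply_eq_re]
  exact A.norm_le_circleNorm _

theorem circleNorm_apply_le (ζ : ℂ) (v : E) :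
    A.circleNorm (A ζ v) ≤ ‖A ζ‖ * A.circleNorm v := by
  obtain ⟨θ, h⟩ := A.exists_norm_circle_apply_eq (A ζ v)
  rw [← h, A.apply_comm]
  exact ((A ζ).le_opNorm _).trans (by gcongr; exact A.norm_circle_apply_le θ v)

theorem continuous_circleNorm_apply (v : E) : Continuous fun s : ℝ => A.circleNorm (A s v) :=
  A.continuous_circleNorm.comp ((A.differentiable_apply v).continuous.comp continuous_ofReal)

/-- The invariant norm along an orbit is bounded by its values at the two ends, by the maximum
principle on a vertical strip. So the orbit cannot leave an invariant ball and come back. -/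
theorem circleNorm_apply_le_max {s t : ℝ} (hs : 0 ≤ s) (hst : s ≤ t) (v : E) :
    A.circleNorm (A s v) ≤ max (A.circleNorm v) (A.circleNorm (A t v)) := by
  rcases hs.eq_or_lt with rfl | hs
  · simp [A.zero_apply]
  rcases hst.eq_or_lt with rfl | hst
  · exact le_max_right _ _
  obtain ⟨θ, h⟩ := A.exists_norm_circle_apply_eq (A s v)
  rw [← h, ← A.add_apply]
  obtain ⟨B, hB⟩ := (isCompact_Icc (a := (0 : ℝ)) (b := t)).exists_bound_of_continuousOn
    (A.continuous_circleNorm_apply v).continuousOn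
  have hzero : A.circleNorm (A (0 : ℝ) v) = A.circleNorm v := by
    rw [ofReal_zero, A.zero_apply]
  refine PhragmenLindelof.vertical_strip (a := 0) (b := t) (f := fun ζ => A ζ v)
    (A.differentiable_apply v).diffContOnCl ?_ ?_ ?_ (z := θ * I + s) (by simpa using hs.le)
    (by simpa using hst.le)
  · refine ⟨0, div_pos Real.pi_pos (by linarith), 0, ?_⟩
    simp only [zero_mul, Real.exp_zero]
    refine Asymptotics.IsBigO.of_bound B ?_
    refine eventually_inf_principal.2 (Eventually.of_forall fun ζ hζ => ?_)
    rw [norm_one, mul_one]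
    refine (A.norm_apply_le_circleNorm_re ζ v).trans ?_
    exact (le_abs_self _).trans (hB ζ.re ⟨hζ.1.le, hζ.2.le⟩)
  · intro ζ hζ
    have := A.norm_apply_le_circleNorm_re ζ v
    rw [hζ, hzero] at this
    exact this.trans (le_max_left _ _)
  · intro ζ hζ
    have := A.norm_apply_le_circleNorm_re ζ v
    rw [hζ] at this
    exact this.trans (le_max_right _ _)

/-- A vector with bounded orbit is fixed, by Liouville's theorem. -/
theorem apply_eq_self_of_bounded {v : E} {R : ℝ} (h : ∀ t : ℝ, A.circleNorm (A t v) ≤ R) (ζ : ℂ) :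
    A ζ v = v := by
  have hb : Bornology.IsBounded (range fun ζ => A ζ v) := by
    rw [isBounded_iff_forall_norm_le]
    refine ⟨R, ?_⟩
    rintro _ ⟨ζ, rfl⟩
    exact (A.norm_apply_le_circleNorm_re ζ v).trans (h _)
  rw [(A.differentiable_apply v).apply_eq_apply_of_bounded hb ζ 0, A.zero_apply]

end Basic

end PeriodicFlow

/-- Two holomorphic functions that agree on a vertical line agree in a neighbourhood. This turns
equivariance under the circle into equivariance under `ℂˣ`. -/
theorem eventuallyEq_of_eventually_eq_add_mul_I {F : Type*} [NormedAddCommGroup F]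
    [NormedSpace ℂ F] {f g : ℂ → F} {ζ₀ : ℂ} (hf : AnalyticAt ℂ f ζ₀) (hg : AnalyticAt ℂ g ζ₀)
    (h : ∀ᶠ θ : ℝ in 𝓝 0, f (ζ₀ + θ * Complex.I) = g (ζ₀ + θ * Complex.I)) : f =ᶠ[𝓝 ζ₀] g := by
  refine (hf.frequently_eq_iff_eventually_eq hg).1 ?_
  have h1 : Tendsto (fun θ : ℝ => ζ₀ + θ * Complex.I) (𝓝[≠] 0) (𝓝[≠] ζ₀) := by
    refine tendsto_nhdsWithin_iff.2 ⟨?_, ?_⟩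
    · have : Continuous fun θ : ℝ => ζ₀ + θ * Complex.I := by fun_prop
      simpa using (this.tendsto 0).mono_left nhdsWithin_le_nhds
    · filter_upwards [self_mem_nhdsWithin] with θ hθ
      simpa using hθ
  exact h1.frequently (h.filter_mono nhdsWithin_le_nhds).frequently

namespace PeriodicFlow

open Complex

section Dynamics

variable {E : Type*} [NormedAddCommGroup E] [NormedSpace ℂ E]
  (A : PeriodicFlow E)

theorem exists_first_exit {δ t : ℝ} {v : E} (hv : A.circleNorm v < δ)
    (h : ¬∀ s ∈ Icc 0 t, A.circleNorm (A s v) < δ) :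
    ∃ s ∈ Icc 0 t, (∀ s' ∈ Icc 0 s, A.circleNorm (A s' v) ≤ δ) ∧ A.circleNorm (A s v) = δ := by
  push Not at h
  obtain ⟨s₁, hs₁, hδ⟩ := h
  have hcont := A.continuous_circleNorm_apply v
  have hcpt : IsCompact (Icc 0 t ∩ {s : ℝ | δ ≤ A.circleNorm (A s v)}) :=
    isCompact_Icc.inter_right (isClosed_le continuous_const hcont)
  obtain ⟨s, ⟨hs, hsδ⟩, hleast⟩ := hcpt.exists_isLeast ⟨s₁, hs₁, hδ⟩
  have hlt : ∀ s' ∈ Ico 0 s, A.circleNorm (A s' v) < δ := by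
    intro s' hs'
    by_contra! hge
    exact absurd (hleast ⟨⟨hs'.1, hs'.2.le.trans hs.2⟩, hge⟩) (not_le.2 hs'.2)
  have heq : A.circleNorm (A s v) = δ := by
    have h0 : A.circleNorm (A (0 : ℝ) v) ≤ δ := by
      rw [Complex.ofReal_zero, A.zero_apply]; exact hv.le
    obtain ⟨s', hs', hs'δ⟩ := intermediate_value_Icc hs.1 hcont.continuousOn ⟨h0, hsδ⟩
    have hs'δ : A.circleNorm (A s' v) = δ := hs'δ
    rcases hs'.2.eq_or_lt with rfl | hlt'
    · exact hs'δ
    · exact absurd hs'δ (hlt s' ⟨hs'.1, hlt'⟩).ne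
  refine ⟨s, hs, fun s' hs' => ?_, heq⟩
  rcases hs'.2.eq_or_lt with rfl | hlt'
  · exact heq.le
  · exact (hlt s' ⟨hs'.1, hlt'⟩).le

/-- The mean of `A` over the circle, which is the projection to the space of fixed vectors. -/
def circleMean : E →L[ℂ] E := (2 * π : ℂ)⁻¹ • ∫ θ : ℝ in 0..2 * π, A (θ * I)

theorem isCompact_circleNorm_le [FiniteDimensional ℂ E] (δ : ℝ) :
    IsCompact {v | A.circleNorm v ≤ δ} := by
  have : ProperSpace E := FiniteDimensional.proper ℂ E
  refine Metric.isCompact_of_isClosed_isBounded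
    (isClosed_le A.continuous_circleNorm continuous_const) ?_
  rw [isBounded_iff_forall_norm_le]
  exact ⟨δ, fun v hv => (A.norm_le_circleNorm v).trans hv⟩

theorem circleMean_apply_eq_integral (v : E) :
    A.circleMean v = (2 * π : ℂ)⁻¹ • ∫ θ : ℝ in 0..2 * π, A (θ * I) v := by
  rw [circleMean, smul_apply]
  congr 1
  exact ContinuousLinearMap.intervalIntegral_apply (A.continuous_circle.intervalIntegrable _ _) v

theorem circleMean_circle_apply (α : ℝ) (v : E) : A.circleMean (A (α * I) v) = A.circleMean v := by
  rw [A.circleMean_apply_eq_integral, A.circleMean_apply_eq_integral]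
  congr 1
  have hper : Function.Periodic (fun θ : ℝ => A (θ * I) v) (2 * π) := fun θ => by
    beta_reduce
    rw [show ((θ + 2 * π : ℝ) : ℂ) * I = θ * I + 2 * π * I by push_cast; ring,
      A.add_two_pi_mul_I]
  have h1 : ∀ θ : ℝ, A (θ * I) (A (α * I) v) = A ((θ + α : ℝ) * I) v := fun θ => by
    rw [← A.add_apply, ← add_mul, ← ofReal_add]
  simp_rw [h1]
  rw [intervalIntegral.integral_comp_add_right (fun θ : ℝ => A (θ * I) v) α, zero_add,
    add_comm (2 * π) α, hper.intervalIntegral_add_eq α 0, zero_add]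

variable [CompleteSpace E]

theorem apply_eq_self_of_circle {v : E}
    (h : ∀ θ : ℝ, A (θ * Complex.I) v = v) (ζ : ℂ) : A ζ v = v := by
  have han : ∀ ζ, AnalyticAt ℂ (fun ζ => A ζ v) ζ :=
    fun ζ => (A.differentiable_apply v).analyticAt ζ
  have h1 := AnalyticOnNhd.eq_of_eventuallyEq (z₀ := (0 : ℂ)) (f := fun ζ => A ζ v)
    (g := fun _ => v) (fun ζ _ => han ζ) (fun _ _ => analyticAt_const)
    (eventuallyEq_of_eventually_eq_add_mul_I (han 0) analyticAt_const
      (Eventually.of_forall fun θ => by rw [zero_add, h]))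
  exact congrFun h1 ζ

theorem circleMean_apply (ζ : ℂ) (v : E) : A.circleMean (A ζ v) = A.circleMean v := by
  have hd : Differentiable ℂ fun ζ => A.circleMean (A ζ v) :=
    A.circleMean.differentiable.comp (A.differentiable_apply v)
  have h := AnalyticOnNhd.eq_of_eventuallyEq (z₀ := (0 : ℂ)) (f := fun ζ => A.circleMean (A ζ v))
    (g := fun _ => A.circleMean v) (fun ζ _ => hd.analyticAt ζ) (fun _ _ => analyticAt_const)
    (eventuallyEq_of_eventually_eq_add_mul_I (hd.analyticAt 0) analyticAt_const
      (Eventually.of_forall fun θ => by rw [zero_add, A.circleMean_circle_apply]))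
  exact congrFun h ζ

theorem circleMean_eq_self {v : E} (h : ∀ ζ, A ζ v = v) : A.circleMean v = v := by
  rw [A.circleMean_apply_eq_integral]
  simp only [h, intervalIntegral.integral_const, sub_zero]
  rw [← Complex.coe_smul, smul_smul]
  push_cast
  rw [inv_mul_cancel₀ (by simp), one_smul]

variable [FiniteDimensional ℂ E]

/-- A function `u` that increases along the flow is positive at a point `q ≠ 0` of mean zero whose
backward orbit stays bounded: a limit point of that orbit has a bounded orbit, so it is fixed, and
its mean is zero, so it is the origin, where `u` vanishes. -/
theorem pos_of_backward_bounded {δ : ℝ} (hδ : 0 < δ) {u : E → ℝ}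
    (hu : ContinuousOn u {v | A.circleNorm v ≤ δ}) (hu0 : u 0 = 0)
    (hmono : ∀ v, (∃ ζ, A ζ v ≠ v) → ∀ t : ℝ, 0 < t →
      (∀ s ∈ Icc 0 t, A.circleNorm (A s v) ≤ δ) → u v < u (A t v))
    {q : E} (hq : A.circleNorm q = δ) (hq0 : A.circleMean q = 0)
    (hback : ∀ s : ℝ, 0 ≤ s → A.circleNorm (A (-s : ℝ) q) ≤ δ) : 0 < u q := by
  have hnf : ∃ ζ, A ζ q ≠ q := by
    by_contra! h
    rw [← A.circleMean_eq_self h, hq0, A.circleNorm_zero] at hq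
    exact hδ.ne hq
  have hnf' : ∀ t : ℝ, ∃ ζ, A ζ (A t q) ≠ A t q := by
    intro t
    obtain ⟨ζ, hζ⟩ := hnf
    refine ⟨ζ, fun h => hζ ?_⟩
    have := congrArg (A (-(t : ℂ))) h
    rwa [A.apply_comm ζ, A.neg_apply_apply, A.neg_apply_apply] at this
  -- going back in time, `u` decreases strictly
  have hdec : ∀ s t : ℝ, 0 ≤ s → s < t → u (A (-t : ℝ) q) < u (A (-s : ℝ) q) := by
    intro s t hs hst
    have h1 : ∀ x : ℝ, A (x : ℂ) (A (-t : ℝ) q) = A (-(t - x) : ℝ) q := fun x => by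
      rw [← A.add_apply, ← ofReal_add]; congr 2; push_cast; ring
    have h2 := hmono (A (-t : ℝ) q) (hnf' _) (t - s) (by linarith) (fun x hx => by
      rw [h1]; exact hback _ (by linarith [hx.2]))
    rwa [h1, sub_sub_cancel] at h2
  obtain ⟨r, hr, φ, hφ, hlim⟩ := (A.isCompact_circleNorm_le δ).tendsto_subseq
    (x := fun m : ℕ => A (-(m : ℝ) : ℝ) q) (fun m => hback m m.cast_nonneg)
  have hφ' : Tendsto (fun m => (φ m : ℝ)) atTop atTop :=
    tendsto_natCast_atTop_atTop.comp hφ.tendsto_atTop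
  -- the limit point has a bounded orbit, hence is fixed; its mean vanishes, so it is the origin
  have hfix : ∀ ζ, A ζ r = r := by
    refine A.apply_eq_self_of_bounded (R := δ) fun s => ?_
    have h1 : Tendsto (fun m => A.circleNorm (A s (A (-(φ m : ℝ) : ℝ) q))) atTop
        (𝓝 (A.circleNorm (A s r))) :=
      ((A.continuous_circleNorm.comp (A s).continuous).tendsto r).comp hlim
    refine le_of_tendsto h1 ?_
    filter_upwards [hφ'.eventually_ge_atTop s] with m hm
    rw [← A.add_apply, ← ofReal_add, show s + -(φ m : ℝ) = -(φ m - s) by ring]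
    exact hback _ (by linarith)
  have hmean : A.circleMean r = 0 := by
    have h1 := (A.circleMean.continuous.tendsto r).comp hlim
    simp only [Function.comp_def, A.circleMean_apply, hq0] at h1
    exact tendsto_nhds_unique h1 tendsto_const_nhds
  have hr0 : r = 0 := by rw [← A.circleMean_eq_self hfix, hmean]
  subst hr0
  have hulim : Tendsto (fun m => u (A (-(φ m : ℝ) : ℝ) q)) atTop (𝓝 0) := by
    have h1 : Tendsto u (𝓝[{v | A.circleNorm v ≤ δ}] 0) (𝓝 0) := by
      have := hu 0 hr
      rwa [ContinuousWithinAt, hu0] at this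
    refine h1.comp (tendsto_nhdsWithin_iff.2 ⟨hlim, Eventually.of_forall fun m => ?_⟩)
    exact hback _ (Nat.cast_nonneg _)
  have h1 : 0 ≤ u (A (-1 : ℝ) q) := by
    refine le_of_tendsto hulim ?_
    filter_upwards [hφ'.eventually_gt_atTop 1] with m hm
    exact (hdec 1 (φ m) zero_le_one hm).le
  have h2 := hdec 0 1 le_rfl zero_lt_one
  rw [neg_zero, ofReal_zero, A.zero_apply] at h2
  exact h1.trans_lt h2

/-- Let `u` vanish at the origin and increase along the flow. Then `u` is bounded below by a
positive constant at the points where orbits that start close to the origin leave the ball of radius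
`δ`. Otherwise a sequence of such exit points accumulates at a point `q` with `u q ≤ 0`; the orbits
spend longer and longer times in the ball, so `q` has a bounded backward orbit, and its mean is the
limit of the means of the starting points, that is zero. This contradicts
`pos_of_backward_bounded`. -/
theorem exists_lt_at_exit {δ : ℝ} (hδ : 0 < δ) {u : E → ℝ}
    (hu : ContinuousOn u {v | A.circleNorm v ≤ δ}) (hu0 : u 0 = 0)
    (hmono : ∀ v, (∃ ζ, A ζ v ≠ v) → ∀ t : ℝ, 0 < t →
      (∀ s ∈ Icc 0 t, A.circleNorm (A s v) ≤ δ) → u v < u (A t v)) :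
    ∃ η > 0, ∃ c > 0, ∀ v, A.circleNorm v < η → ∀ t : ℝ, 0 ≤ t →
      (∀ s ∈ Icc 0 t, A.circleNorm (A s v) ≤ δ) → A.circleNorm (A t v) = δ → c < u (A t v) := by
  by_contra! H
  have H' : ∀ m : ℕ, ∃ v, A.circleNorm v < 1 / ((m : ℝ) + 1) ∧ ∃ t : ℝ, 0 ≤ t ∧
      (∀ s ∈ Icc 0 t, A.circleNorm (A s v) ≤ δ) ∧ A.circleNorm (A t v) = δ ∧
      u (A t v) ≤ 1 / ((m : ℝ) + 1) := fun m => by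
    obtain ⟨v, h1, t, h2, h3, h4, h5⟩ := H (1 / ((m : ℝ) + 1)) (by positivity)
      (1 / ((m : ℝ) + 1)) (by positivity)
    exact ⟨v, h1, t, h2, h3, h4, h5⟩
  choose v hv t ht hstay hexit hle using H'
  have hv0 : Tendsto v atTop (𝓝 0) := by
    refine squeeze_zero_norm (fun m => ?_) tendsto_one_div_add_atTop_nhds_zero_nat
    exact (A.norm_le_circleNorm _).trans (hv m).le
  -- orbits that start close to the origin need a long time to get out
  have htlim : Tendsto t atTop atTop := by
    refine tendsto_atTop.2 fun T => ?_
    obtain ⟨C, hC⟩ := (isCompact_Icc (a := (0 : ℝ)) (b := T)).exists_bound_of_continuousOn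
      (f := fun s : ℝ => A (s : ℂ)) (A.continuous.comp continuous_ofReal).continuousOn
    have h1 : Tendsto (fun m : ℕ => C * (1 / ((m : ℝ) + 1))) atTop (𝓝 0) := by
      simpa using tendsto_one_div_add_atTop_nhds_zero_nat.const_mul C
    filter_upwards [h1.eventually_lt_const hδ] with m hm
    by_contra! hlt
    have hCm := hC (t m) ⟨ht m, hlt.le⟩
    have h2 := A.circleNorm_apply_le (t m) (v m)
    rw [hexit] at h2
    have h3 : ‖A (t m : ℂ)‖ * A.circleNorm (v m) ≤ C * (1 / ((m : ℝ) + 1)) := by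
      gcongr
      · exact A.circleNorm_nonneg _
      · exact (norm_nonneg _).trans hCm
      · exact (hv m).le
    linarith
  obtain ⟨q, hq, φ, hφ, hlim⟩ := (A.isCompact_circleNorm_le δ).tendsto_subseq
    (x := fun m : ℕ => A (t m) (v m)) (fun m => (hexit m).le)
  have hqN : A.circleNorm q = δ := by
    have h1 := (A.continuous_circleNorm.tendsto q).comp hlim
    simp only [Function.comp_def, hexit] at h1
    exact tendsto_nhds_unique h1 tendsto_const_nhds
  have hmean : A.circleMean q = 0 := by
    have h1 := (A.circleMean.continuous.tendsto q).comp hlim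
    simp only [Function.comp_def, A.circleMean_apply] at h1
    have h2 := (A.circleMean.continuous.tendsto 0).comp (hv0.comp hφ.tendsto_atTop)
    rw [_root_.map_zero] at h2
    exact tendsto_nhds_unique h1 h2
  have hback : ∀ s : ℝ, 0 ≤ s → A.circleNorm (A (-s : ℝ) q) ≤ δ := by
    intro s hs
    have h1 : Tendsto (fun m => A.circleNorm (A (-s : ℝ) (A (t (φ m)) (v (φ m))))) atTop
        (𝓝 (A.circleNorm (A (-s : ℝ) q))) :=
      ((A.continuous_circleNorm.comp (A (-s : ℝ)).continuous).tendsto q).comp hlim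
    refine le_of_tendsto h1 ?_
    filter_upwards [(htlim.comp hφ.tendsto_atTop).eventually_ge_atTop s] with m hm
    rw [← A.add_apply, ← ofReal_add]
    have hm : s ≤ t (φ m) := hm
    exact hstay (φ m) _ ⟨by linarith, by linarith⟩
  have hupos := A.pos_of_backward_bounded hδ hu hu0 hmono hqN hmean hback
  have hule : u q ≤ 0 := by
    have h1 : Tendsto (fun m => u (A (t (φ m)) (v (φ m)))) atTop (𝓝 (u q)) :=
      (hu q hq).tendsto.comp (tendsto_nhdsWithin_iff.2
        ⟨hlim, Eventually.of_forall fun m => (hexit (φ m)).le⟩)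
    refine le_of_tendsto_of_tendsto h1
      (tendsto_one_div_add_atTop_nhds_zero_nat.comp hφ.tendsto_atTop) ?_
    exact Eventually.of_forall fun m => hle (φ m)
  linarith

end Dynamics

end PeriodicFlow

/-! ### The action in the exponential variable, and the moment map -/

/-- The exponential as a map `ℂ → ℂˣ`. -/
def expUnit (ζ : ℂ) : ℂˣ := Units.mk0 (Complex.exp ζ) (Complex.exp_ne_zero ζ)

theorem val_expUnit (ζ : ℂ) : (expUnit ζ : ℂ) = Complex.exp ζ := rfl

theorem expUnit_zero : expUnit 0 = 1 := Units.ext (by simp [val_expUnit])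

theorem expUnit_add (ζ ζ' : ℂ) : expUnit (ζ + ζ') = expUnit ζ * expUnit ζ' :=
  Units.ext (by simp [val_expUnit, Complex.exp_add])

theorem expUnit_log (c : ℂˣ) : expUnit (Complex.log c) = c :=
  Units.ext (by rw [val_expUnit, Complex.exp_log c.ne_zero])

theorem expUnit_two_pi_mul_I : expUnit (2 * π * Complex.I) = 1 :=
  Units.ext (by rw [val_expUnit, Complex.exp_two_pi_mul_I, Units.val_one])

theorem expUnit_mul_I (θ : ℝ) : expUnit (θ * Complex.I) = Circle.toUnits (Circle.exp θ) :=
  Units.ext (by simp [val_expUnit, Circle.coe_exp])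

theorem contMDiff_expUnit : ContMDiff 𝓘(ℂ, ℂ) 𝓘(ℂ, ℂ) ω expUnit := by
  apply ContMDiff.of_comp_isOpenEmbedding Units.isOpenEmbedding_val
  exact (Complex.contDiff_exp (𝕜 := ℂ)).contMDiff

section RestrictScalars

variable {E E' : Type*} [NormedAddCommGroup E] [NormedSpace ℂ E] [NormedAddCommGroup E']
  [NormedSpace ℂ E'] {M M' : Type*} [TopologicalSpace M] [ChartedSpace E M] [TopologicalSpace M']
  [ChartedSpace E' M']

/-- The complex manifold and the underlying real manifold have the same charts, so complex
derivatives are real derivatives. -/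
theorem HasMFDerivAt.restrictScalars_real {f : M → M'} {x : M} {f' : E →L[ℂ] E'}
    (h : HasMFDerivAt 𝓘(ℂ, E) 𝓘(ℂ, E') f x f') :
    HasMFDerivAt 𝓘(ℝ, E) 𝓘(ℝ, E') f x (f'.restrictScalars ℝ) :=
  ⟨h.1, HasFDerivWithinAt.restrictScalars ℝ h.2⟩

end RestrictScalars

section Action

variable {M : Type*} [MulAction ℂˣ M]

theorem expUnit_mul_I_smul_of_mem {x : M} (hx : x ∈ circleFixedPoints M) (θ : ℝ) :
    expUnit (θ * Complex.I) • x = x := by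
  rw [expUnit_mul_I]; exact hx _

theorem expUnit_add_smul (ζ ζ' : ℂ) (x : M) :
    expUnit (ζ + ζ') • x = expUnit ζ • expUnit ζ' • x := by rw [expUnit_add, mul_smul]

theorem expUnit_smul_periodic (x : M) :
    Function.Periodic (fun θ : ℝ => expUnit (θ * Complex.I) • x) (2 * π) := fun θ => by
  beta_reduce
  rw [show ((θ + 2 * π : ℝ) : ℂ) * Complex.I = θ * Complex.I + 2 * π * Complex.I by
    push_cast; ring, expUnit_add, expUnit_two_pi_mul_I, mul_one]

theorem smul_mem_circleFixedPoints_iff (c : ℂˣ) (x : M) :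
    c • x ∈ circleFixedPoints M ↔ x ∈ circleFixedPoints M := by
  refine forall_congr' fun z => ?_
  rw [smul_comm]
  exact smul_left_cancel_iff c

theorem continuous_expUnit_smul [TopologicalSpace M] [ContinuousSMul ℂˣ M] :
    Continuous fun z : ℂ × M => expUnit z.1 • z.2 :=
  (contMDiff_expUnit.continuous.comp continuous_fst).smul continuous_snd

end Action

theorem analyticAt_chart_comp {n : ℕ} {M : Type*} [TopologicalSpace M] [ChartedSpace (Cn n) M]
    {E : Type*} [NormedAddCommGroup E] [NormedSpace ℂ E] {f : E → M} {z : E}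
    (hf : ContMDiffAt 𝓘(ℂ, E) 𝓘(ℂ, Cn n) ω f z) {e : OpenPartialHomeomorph M (Cn n)}
    (he : IsBiholomorphism (n := n) e) (hz : f z ∈ e.source) : AnalyticAt ℂ (fun w => e (f w)) z :=
  (contMDiffAt_iff_contDiffAt.1
    (((he.holomorphic _ hz).contMDiffAt (e.open_source.mem_nhds hz)).comp z hf)).analyticAt

theorem isBiholomorphism_chartAt {n : ℕ} {M : Type*} [TopologicalSpace M] [ChartedSpace (Cn n) M]
    [IsManifold 𝓘(ℂ, Cn n) ω M] (p : M) : IsBiholomorphism (n := n) (chartAt (Cn n) p) :=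
  ⟨contMDiffOn_chart, contMDiffOn_chart_symm⟩

section Manifold

variable {n : ℕ} {M : Type*} [TopologicalSpace M] [ChartedSpace (Cn n) M] [MulAction ℂˣ M]
  [ContMDiffSMul 𝓘(ℂ, ℂ) 𝓘(ℂ, Cn n) ω ℂˣ M]

theorem contMDiff_expUnit_smul (x : M) :
    ContMDiff 𝓘(ℂ, ℂ) 𝓘(ℂ, Cn n) ω fun ζ => expUnit ζ • x :=
  contMDiff_expUnit.smul contMDiff_const

/-- The moment map increases strictly along the orbits of the positive reals. If `D` is the
derivative of `ζ ↦ exp ζ • x`, the circle field is `ξ = D i = i D 1`, so the velocity of the real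
orbit is `D 1 = -J ξ`, and `dΨ(-J ξ) = Ω(ξ, J ξ) > 0`. -/
theorem strictMono_momentMap {Ω : TwoForm n M} (htame : Ω.IsTamedByAction) {Ψ : M → ℝ}
    (hΨ : Ω.IsMomentMap Ψ) {x : M} (hx : x ∉ circleFixedPoints M) :
    StrictMono fun t : ℝ => Ψ (expUnit t • x) := by
  refine strictMono_of_deriv_pos fun t => ?_
  set γ : ℂ → M := fun ζ => expUnit ζ • x with hγ
  set y : M := γ t with hy
  have hd : MDifferentiableAt 𝓘(ℂ, ℂ) 𝓘(ℂ, Cn n) γ (t : ℂ) :=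
    (contMDiff_expUnit_smul x).mdifferentiableAt (by simp)
  set D : ℂ →L[ℂ] Cn n := mfderiv 𝓘(ℂ, ℂ) 𝓘(ℂ, Cn n) γ (t : ℂ) with hD
  have hγD : HasMFDerivAt 𝓘(ℝ, ℂ) 𝓘(ℝ, Cn n) γ (t : ℂ) (D.restrictScalars ℝ) :=
    HasMFDerivAt.restrictScalars_real hd.hasMFDerivAt
  -- the velocity of the circle action at `y = exp t • x` is `i • D 1`
  have hξ : circleField y = (Complex.I • D 1 : Cn n) := by
    have h1 : HasMFDerivAt 𝓘(ℝ, ℝ) 𝓘(ℝ, ℂ) (fun θ : ℝ => (t : ℂ) + θ * Complex.I) 0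
        ((Complex.ofRealCLM.smulRight Complex.I : ℝ →L[ℝ] ℂ)) := by
      refine HasFDerivAt.hasMFDerivAt ?_
      exact (Complex.ofRealCLM.hasFDerivAt.mul_const' Complex.I).const_add (t : ℂ)
    have hγD' : HasMFDerivAt 𝓘(ℝ, ℂ) 𝓘(ℝ, Cn n) γ ((t : ℂ) + (0 : ℝ) * Complex.I)
        (D.restrictScalars ℝ) := by
      rw [show (t : ℂ) + (0 : ℝ) * Complex.I = t by simp]
      exact hγD
    have h2 := HasMFDerivAt.comp (0 : ℝ) hγD' h1
    have h3 : (γ ∘ fun θ : ℝ => (t : ℂ) + θ * Complex.I) =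
        fun θ : ℝ => Circle.toUnits (Circle.exp θ) • y := by
      funext θ
      simp only [Function.comp, hγ, hy]
      rw [← expUnit_mul_I, ← expUnit_add_smul, add_comm]
    rw [h3] at h2
    have h4 := congrArg (fun L : ℝ →L[ℝ] Cn n => L 1) h2.mfderiv
    refine h4.trans ?_
    change D ((1 : ℝ) • Complex.I) = _
    rw [one_smul, ← map_smul, smul_eq_mul, mul_one]
  have hyfix : y ∉ circleFixedPoints M := by
    rwa [hy, hγ, smul_mem_circleFixedPoints_iff]
  have hpos := htame y hyfix
  have hJ : J y (circleField y) = (-(D 1) : Cn n) := by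
    rw [hξ]
    change Complex.I • Complex.I • D 1 = _
    rw [smul_smul, Complex.I_mul_I, neg_one_smul]
  set L : Cn n →L[ℝ] ℝ := mfderiv 𝓘(ℝ, Cn n) 𝓘(ℝ, ℝ) Ψ y with hL
  have hΨd : HasMFDerivAt 𝓘(ℝ, Cn n) 𝓘(ℝ, ℝ) Ψ y L :=
    (hΨ.smooth.mdifferentiableAt (by simp)).hasMFDerivAt
  have hof : HasMFDerivAt 𝓘(ℝ, ℝ) 𝓘(ℝ, ℂ) (fun s : ℝ => (s : ℂ)) t Complex.ofRealCLM :=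
    Complex.ofRealCLM.hasFDerivAt.hasMFDerivAt
  have hcomp := HasMFDerivAt.comp t hΨd (HasMFDerivAt.comp t hγD hof)
  have hderiv : HasDerivAt (fun t : ℝ => Ψ (expUnit t • x)) (L (D 1)) t := by
    have h1 : HasFDerivAt (fun t : ℝ => Ψ (expUnit t • x))
        (L.comp ((D.restrictScalars ℝ).comp Complex.ofRealCLM)) t := hcomp.hasFDerivAt
    have h2 := h1.hasDerivAt
    simpa using h2
  rw [hderiv.deriv]
  have h5 : Ω y ![circleField y, J y (circleField y)] = -L (J y (circleField y)) :=
    hΨ.contract_eq y (J y (circleField y))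
  rw [h5, hJ] at hpos
  have h6 : L (-(D 1)) = -L (D 1) := map_neg _ _
  linarith

end Manifold

/-! ### Holomorphic linearization at a fixed point -/

section Linearization

variable {n : ℕ} {M : Type*} [TopologicalSpace M] [ChartedSpace (Cn n) M]
  [IsManifold 𝓘(ℂ, Cn n) ω M] [MulAction ℂˣ M] [ContMDiffSMul 𝓘(ℂ, ℂ) 𝓘(ℂ, Cn n) ω ℂˣ M]

/-- A fixed point of the circle is fixed by `ℂˣ`. By the identity theorem it is fixed by `exp ζ` for
small `ζ`, and `exp ζ` is a power of `exp (ζ / (m + 1))`. -/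
theorem expUnit_smul_eq_self (n : ℕ) {M : Type*} [TopologicalSpace M] [ChartedSpace (Cn n) M]
    [IsManifold 𝓘(ℂ, Cn n) ω M] [MulAction ℂˣ M] [ContMDiffSMul 𝓘(ℂ, ℂ) 𝓘(ℂ, Cn n) ω ℂˣ M]
    {p : M} (hp : p ∈ circleFixedPoints M) (ζ : ℂ) : expUnit ζ • p = p := by
  set φ := chartAt (Cn n) p with hφ
  have hpφ : p ∈ φ.source := mem_chart_source _ p
  have hp0 : expUnit 0 • p = p := by rw [expUnit_zero, one_smul]
  have han : AnalyticAt ℂ (fun ζ => φ (expUnit ζ • p)) 0 :=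
    analyticAt_chart_comp (contMDiff_expUnit_smul p 0) (isBiholomorphism_chartAt p)
      (by rwa [hp0])
  have hev := eventuallyEq_of_eventually_eq_add_mul_I han (g := fun _ => φ p) analyticAt_const
    (Eventually.of_forall fun θ => by
      rw [zero_add, expUnit_mul_I_smul_of_mem hp])
  have hsrc : ∀ᶠ ζ in 𝓝 (0 : ℂ), expUnit ζ • p ∈ φ.source :=
    (contMDiff_expUnit_smul (n := n) p).continuous.continuousAt.eventually_mem
      (φ.open_source.mem_nhds (by rwa [hp0]))
  have hloc : ∀ᶠ ζ in 𝓝 (0 : ℂ), expUnit ζ • p = p := by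
    filter_upwards [hev, hsrc] with ζ h1 h2
    exact φ.injOn h2 hpφ h1
  have hlim : Tendsto (fun m : ℕ => ζ * ((1 / ((m : ℝ) + 1) : ℝ) : ℂ)) atTop (𝓝 0) := by
    have h1 := (Complex.continuous_ofReal.tendsto 0).comp
      tendsto_one_div_add_atTop_nhds_zero_nat
    simpa using h1.const_mul ζ
  obtain ⟨m, hm⟩ := (hlim.eventually hloc).exists
  have hpow : ∀ j : ℕ, expUnit (j * (ζ * ((1 / ((m : ℝ) + 1) : ℝ) : ℂ))) • p = p := by
    intro j
    induction j with
    | zero => simp [expUnit_zero]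
    | succ j ih => rw [Nat.cast_succ, add_mul, one_mul, expUnit_add_smul, hm, ih]
  have h2 := hpow (m + 1)
  have h3 : ((m + 1 : ℕ) : ℂ) * (ζ * ((1 / ((m : ℝ) + 1) : ℝ) : ℂ)) = ζ := by
    have : (m : ℂ) + 1 ≠ 0 := by exact_mod_cast Nat.succ_ne_zero m
    push_cast
    field_simp
  rwa [h3] at h2

variable (n) in
/-- The action of `exp ζ` read in the chart at `p`. The value is meaningful where
`exp ζ • (chartAt p).symm y` lies in the domain of the chart. -/
def localAction (p : M) (ζ : ℂ) (y : Cn n) : Cn n :=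
  chartAt (Cn n) p (expUnit ζ • (chartAt (Cn n) p).symm y)

theorem analyticAt_localAction {p : M} {ζ : ℂ} {y : Cn n} (hy : y ∈ (chartAt (Cn n) p).target)
    (h : expUnit ζ • (chartAt (Cn n) p).symm y ∈ (chartAt (Cn n) p).source) :
    AnalyticAt ℂ (Function.uncurry (localAction n p)) (ζ, y) := by
  refine analyticAt_chart_comp (f := fun z : ℂ × Cn n => expUnit z.1 • (chartAt (Cn n) p).symm z.2)
    (z := (ζ, y)) ?_ (isBiholomorphism_chartAt p) h
  refine ContMDiffAt.smul (I := 𝓘(ℂ, ℂ)) ?_ ?_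
  · exact (contMDiff_expUnit.comp (contDiff_fst (𝕜 := ℂ)).contMDiff) _
  · have h1 : ContMDiffAt 𝓘(ℂ, Cn n) 𝓘(ℂ, Cn n) ω (chartAt (Cn n) p).symm y :=
      (contMDiffOn_chart_symm y hy).contMDiffAt ((chartAt (Cn n) p).open_target.mem_nhds hy)
    exact ContMDiffAt.comp (ζ, y) (g := (chartAt (Cn n) p).symm)
      (f := fun z : ℂ × Cn n => z.2) h1 ((contDiff_snd (𝕜 := ℂ)).contMDiff _)

theorem analyticAt_localAction_of_fixed {p : M} (hp : p ∈ circleFixedPoints M) (ζ : ℂ) :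
    AnalyticAt ℂ (Function.uncurry (localAction n p)) (ζ, chartAt (Cn n) p p) := by
  refine analyticAt_localAction (mem_chart_target _ p) ?_
  rw [(chartAt (Cn n) p).left_inv (mem_chart_source _ p), expUnit_smul_eq_self n hp]
  exact mem_chart_source _ p

theorem localAction_apply_self {p : M} (hp : p ∈ circleFixedPoints M) (ζ : ℂ) :
    localAction n p ζ (chartAt (Cn n) p p) = chartAt (Cn n) p p := by
  rw [localAction, (chartAt (Cn n) p).left_inv (mem_chart_source _ p), expUnit_smul_eq_self n hp]

theorem hasFDerivAt_localAction {p : M} (hp : p ∈ circleFixedPoints M) (ζ : ℂ) :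
    HasFDerivAt (localAction n p ζ) (fderiv ℂ (localAction n p ζ) (chartAt (Cn n) p p))
      (chartAt (Cn n) p p) := by
  have h1 : AnalyticAt ℂ (fun y => Function.uncurry (localAction n p) (ζ, y))
      (chartAt (Cn n) p p) :=
    AnalyticAt.comp (f := fun y => (ζ, y)) (analyticAt_localAction_of_fixed hp ζ) (by fun_prop)
  exact h1.differentiableAt.hasFDerivAt

/-- The isotropy representation of `ℂˣ` on the tangent space at a fixed point `p`, which the chart
at `p` identifies with `ℂⁿ`. -/
def isotropyFlow {p : M} (hp : p ∈ circleFixedPoints M) : PeriodicFlow (Cn n) where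
  toFun ζ := fderiv ℂ (localAction n p ζ) (chartAt (Cn n) p p)
  map_zero := by
    have h1 : localAction n p 0 =ᶠ[𝓝 (chartAt (Cn n) p p)] id := by
      filter_upwards [(chartAt (Cn n) p).open_target.mem_nhds (mem_chart_target _ p)] with y hy
      rw [localAction, expUnit_zero, one_smul, (chartAt (Cn n) p).right_inv hy, id]
    rw [h1.fderiv_eq, fderiv_id]
    rfl
  map_add ζ ζ' := by
    have h1 : localAction n p (ζ + ζ') =ᶠ[𝓝 (chartAt (Cn n) p p)]
        localAction n p ζ ∘ localAction n p ζ' := by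
      have hc : ContinuousAt (fun y => expUnit ζ' • (chartAt (Cn n) p).symm y)
          (chartAt (Cn n) p p) := by
        have h3 : ContMDiff 𝓘(ℂ, Cn n) 𝓘(ℂ, Cn n) ω fun x : M => expUnit ζ' • x :=
          ContMDiffSMul.contMDiff_const_smul (I := 𝓘(ℂ, ℂ)) (expUnit ζ')
        exact h3.continuous.continuousAt.comp
          ((chartAt (Cn n) p).continuousAt_symm (mem_chart_target _ p))
      have hev := hc.eventually_mem ((chartAt (Cn n) p).open_source.mem_nhds (by
        rw [(chartAt (Cn n) p).left_inv (mem_chart_source _ p), expUnit_smul_eq_self n hp]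
        exact mem_chart_source _ p))
      filter_upwards [hev] with y hy
      rw [Function.comp, localAction, localAction, localAction,
        (chartAt (Cn n) p).left_inv hy, expUnit_add_smul]
    rw [h1.fderiv_eq]
    have h2 := hasFDerivAt_localAction (n := n) hp ζ
    rw [← localAction_apply_self hp ζ'] at h2
    rw [(h2.comp _ (hasFDerivAt_localAction hp ζ')).fderiv, localAction_apply_self hp ζ']
    rfl
  differentiable := by
    intro ζ
    have h1 : ContDiffAt ℂ ω (Function.uncurry (localAction n p)) (ζ, chartAt (Cn n) p p) :=
      (analyticAt_localAction_of_fixed hp ζ).contDiffAt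
    exact (h1.fderiv (g := fun _ => chartAt (Cn n) p p) (m := ω) contDiffAt_const
      (by simp)).differentiableAt (by simp)
  periodic := by
    have h1 : localAction n p (2 * π * Complex.I) =ᶠ[𝓝 (chartAt (Cn n) p p)] id := by
      filter_upwards [(chartAt (Cn n) p).open_target.mem_nhds (mem_chart_target _ p)] with y hy
      rw [localAction, expUnit_two_pi_mul_I, one_smul, (chartAt (Cn n) p).right_inv hy, id]
    rw [h1.fderiv_eq, fderiv_id]
    rfl

/-- The average over the circle of the conjugates `x ↦ A(-iθ) (φ(exp(iθ) • x) - φ(p))` of the chart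
`φ` at `p`, where `A` is the isotropy representation. -/
def averagedChart {p : M} (hp : p ∈ circleFixedPoints M) (x : M) : Cn n :=
  (2 * π : ℂ)⁻¹ • ∫ θ : ℝ in 0..2 * π, isotropyFlow hp (-(θ * Complex.I))
    (chartAt (Cn n) p (expUnit (θ * Complex.I) • x) - chartAt (Cn n) p p)

theorem averagedChart_self {p : M} (hp : p ∈ circleFixedPoints M) :
    averagedChart (n := n) hp p = 0 := by
  simp [averagedChart, expUnit_smul_eq_self n hp]

/-- The averaged chart intertwines the circle action with the isotropy representation. -/
theorem averagedChart_circle_smul {p : M} (hp : p ∈ circleFixedPoints M) {x : M}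
    (hx : ∀ θ : ℝ, expUnit (θ * Complex.I) • x ∈ (chartAt (Cn n) p).source) (α : ℝ) :
    averagedChart (n := n) hp (expUnit (α * Complex.I) • x) =
      isotropyFlow hp (α * Complex.I) (averagedChart hp x) := by
  set A := isotropyFlow (n := n) hp with hA
  set k : ℝ → Cn n := fun θ => A (-(θ * Complex.I))
    (chartAt (Cn n) p (expUnit (θ * Complex.I) • x) - chartAt (Cn n) p p) with hk
  have hkc : Continuous k := by
    have h1 : Continuous fun θ : ℝ => expUnit (θ * Complex.I) • x :=
      (contMDiff_expUnit_smul (n := n) x).continuous.comp (by fun_prop)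
    have h2 : Continuous fun θ : ℝ => chartAt (Cn n) p (expUnit (θ * Complex.I) • x) := by
      rw [continuous_iff_continuousAt]
      exact fun θ => ContinuousAt.comp (f := fun θ : ℝ => expUnit (θ * Complex.I) • x)
        ((chartAt (Cn n) p).continuousAt (hx θ)) h1.continuousAt
    exact (A.continuous.comp (f := fun θ : ℝ => -(θ * Complex.I)) (by fun_prop)).clm_apply
      (h2.sub continuous_const)
  have hkp : Function.Periodic k (2 * π) := by
    intro θ
    simp only [hk]
    rw [show A (-(((θ + 2 * π : ℝ) : ℂ) * Complex.I)) = A (-(θ * Complex.I)) from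
      A.eq_of_exp_eq (Complex.exp_eq_exp_iff_exists_int.2 ⟨-1, by push_cast; ring⟩)]
    rw [show expUnit (((θ + 2 * π : ℝ) : ℂ) * Complex.I) • x = expUnit (θ * Complex.I) • x from
      expUnit_smul_periodic x θ]
  have h1 : ∀ θ : ℝ, A (-(θ * Complex.I)) (chartAt (Cn n) p (expUnit (θ * Complex.I) •
      expUnit (α * Complex.I) • x) - chartAt (Cn n) p p) = A (α * Complex.I) (k (θ + α)) := by
    intro θ
    simp only [hk]
    rw [← A.add_apply, ← expUnit_add_smul, ← add_mul, ← Complex.ofReal_add]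
    congr 2
    push_cast; ring
  simp only [averagedChart]
  simp_rw [← hA, h1]
  have h2 : ∫ θ : ℝ in 0..2 * π, A (α * Complex.I) (k (θ + α)) =
      A (α * Complex.I) (∫ θ : ℝ in 0..2 * π, k (θ + α)) :=
    ContinuousLinearMap.intervalIntegral_comp_comm _
      ((hkc.comp (continuous_add_const α)).intervalIntegrable _ _)
  rw [h2, intervalIntegral.integral_comp_add_right k α, zero_add, add_comm (2 * π) α,
    hkp.intervalIntegral_add_eq α 0, zero_add, map_smul]

/-- In the chart at `p`, the averaged chart is analytic at `p` with derivative the identity. -/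
theorem contDiffAt_averagedChart {p : M} (hp : p ∈ circleFixedPoints M) :
    ContDiffAt ℂ ω (averagedChart (n := n) hp ∘ (chartAt (Cn n) p).symm) (chartAt (Cn n) p p) ∧
    HasFDerivAt (averagedChart (n := n) hp ∘ (chartAt (Cn n) p).symm)
      (ContinuousLinearEquiv.refl ℂ (Cn n) : Cn n →L[ℂ] Cn n) (chartAt (Cn n) p p) := by
  set A := isotropyFlow (n := n) hp with hA
  set f : ℂ → Cn n → Cn n := fun ζ y => A (-ζ) (localAction n p ζ y - chartAt (Cn n) p p) with hf
  have hγ : Continuous fun θ : ℝ => (θ : ℂ) * Complex.I := by fun_prop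
  have han : ∀ θ : ℝ, AnalyticAt ℂ (Function.uncurry f) (θ * Complex.I, chartAt (Cn n) p p) := by
    intro θ
    have h1 : AnalyticAt ℂ (fun z : ℂ × Cn n => A (-z.1)) (θ * Complex.I, chartAt (Cn n) p p) :=
      AnalyticAt.comp (f := fun z : ℂ × Cn n => -z.1) (A.differentiable.analyticAt _)
        analyticAt_fst.neg
    exact (h1.contDiffAt.clm_apply (n := ω)
      ((analyticAt_localAction_of_fixed hp _).sub analyticAt_const).contDiffAt).analyticAt
  have hF : averagedChart (n := n) hp ∘ (chartAt (Cn n) p).symm =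
      fun y => (2 * π : ℂ)⁻¹ • ∫ θ : ℝ in 0..2 * π, f (θ * Complex.I) y := rfl
  rw [hF]
  refine ⟨(analyticAt_intervalIntegral hγ han 0 (2 * π)).contDiffAt.const_smul _, ?_⟩
  have h1 := (hasFDerivAt_intervalIntegral hγ han 0 (2 * π)).const_smul (2 * π : ℂ)⁻¹
  have h2 : ∀ θ : ℝ, fderiv ℂ (f (θ * Complex.I)) (chartAt (Cn n) p p) = 1 := by
    intro θ
    have h3 := (A (-(θ * Complex.I))).hasFDerivAt.comp (chartAt (Cn n) p p)
      ((hasFDerivAt_localAction (n := n) hp (θ * Complex.I)).sub_const (chartAt (Cn n) p p))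
    refine h3.fderiv.trans ?_
    change A (-(θ * Complex.I)) * A (θ * Complex.I) = 1
    rw [← A.map_add, neg_add_cancel, A.map_zero]
  simp_rw [h2] at h1
  refine h1.congr_fderiv ?_
  rw [intervalIntegral.integral_const, sub_zero, ← Complex.coe_smul, smul_smul]
  push_cast
  rw [inv_mul_cancel₀ (by simp), one_smul]
  rfl

variable (n) in
/-- A holomorphic chart centred at `p` whose inverse, on a ball of the invariant norm of a periodic
flow, intertwines the flow of the circle with the action. -/
structure LinearizingChart (p : M) where
  flow : PeriodicFlow (Cn n)
  chart : OpenPartialHomeomorph M (Cn n)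
  isBiholomorphism : IsBiholomorphism (n := n) chart
  mem_source : p ∈ chart.source
  map_point : chart p = 0
  radius : ℝ
  radius_pos : 0 < radius
  mem_target : ∀ v, flow.circleNorm v < radius → v ∈ chart.target
  circle_smul_symm : ∀ v, flow.circleNorm v < radius → ∀ θ : ℝ,
    expUnit (θ * Complex.I) • chart.symm v = chart.symm (flow (θ * Complex.I) v)

/-- Holomorphic linearization of the circle action at a fixed point: by the inverse function theorem
the averaged chart is a chart near `p`, and the ball is chosen such that the circle orbits of its
points stay in the domain of this chart. -/
theorem exists_linearizingChart {p : M} (hp : p ∈ circleFixedPoints M) {V : Set M}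
    (hV : IsOpen V) (hpV : p ∈ V) : ∃ L : LinearizingChart n p, L.chart.source ⊆ V := by
  obtain ⟨hF, hF'⟩ := contDiffAt_averagedChart (n := n) hp
  set φ := chartAt (Cn n) p with hφ
  have hpφ : p ∈ φ.source := mem_chart_source _ p
  set A := isotropyFlow (n := n) hp with hA
  set F := averagedChart (n := n) hp ∘ φ.symm with hFdef
  set e₁ := hF.toOpenPartialHomeomorph F hF' (by simp) with he₁
  set e₀ := e₁.restrContDiff ℂ ω (by simp) with he₀
  set e := (φ.trans e₀).restrOpen V hV with he
  have heV : e.source ⊆ V := fun x hx => by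
    rw [he, OpenPartialHomeomorph.restrOpen_source] at hx; exact hx.2
  have heφ : e.source ⊆ φ.source := fun x hx => by
    rw [he, OpenPartialHomeomorph.restrOpen_source, OpenPartialHomeomorph.trans_source] at hx
    exact hx.1.1
  have he_apply : ∀ x ∈ φ.source, e x = averagedChart (n := n) hp x := by
    intro x hx
    change averagedChart (n := n) hp (φ.symm (φ x)) = _
    rw [φ.left_inv hx]
  have hep : e p = 0 := by rw [he_apply p hpφ, averagedChart_self]
  have h1 : φ p ∈ e₀.source :=
    ⟨hF.mem_toOpenPartialHomeomorph_source hF' (by simp), hF, hF.to_localInverse hF' (by simp)⟩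
  have hpe : p ∈ e.source := by
    rw [he, OpenPartialHomeomorph.restrOpen_source, OpenPartialHomeomorph.trans_source]
    exact ⟨⟨hpφ, h1⟩, hpV⟩
  have hbi : IsBiholomorphism (n := n) e := by
    constructor
    · refine ContMDiffOn.comp (g := e₀) (f := φ) (t := e₀.source)
        (e₁.contDiffOn_restrContDiff_source ℂ (by simp)).contMDiffOn
        (contMDiffOn_chart.mono heφ) fun x hx => ?_
      rw [he, OpenPartialHomeomorph.restrOpen_source, OpenPartialHomeomorph.trans_source] at hx
      exact hx.1.2
    · have ht : e.target ⊆ e₀.target ∩ e₀.symm ⁻¹' φ.target := by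
        intro y hy
        have h2 := e.map_target hy
        have h3 := e.right_inv hy
        rw [he, OpenPartialHomeomorph.restrOpen_source] at h2
        rw [← OpenPartialHomeomorph.trans_target, ← h3]
        exact (φ.trans e₀).map_source h2.1
      exact ContMDiffOn.comp (g := φ.symm) (f := e₀.symm) (t := φ.target) contMDiffOn_chart_symm
        ((e₁.contDiffOn_restrContDiff_target ℂ (by simp)).contMDiffOn.mono fun y hy => (ht hy).1)
        fun y hy => (ht hy).2
  -- the points whose circle orbit stays in the domain of the chart
  have : ContinuousSMul ℂˣ M :=
    ContMDiffSMul.continuousSMul (I := 𝓘(ℂ, ℂ)) (I' := 𝓘(ℂ, Cn n)) ω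
  have horbit : ∀ᶠ x in 𝓝 p, ∀ θ : ℝ, expUnit (θ * Complex.I) • x ∈ e.source := by
    have h2 : ∀ᶠ x in 𝓝 p, ∀ θ ∈ Icc (0 : ℝ) (2 * π),
        expUnit (θ * Complex.I) • x ∈ e.source := by
      refine isCompact_Icc.eventually_forall_of_forall_eventually fun θ _ => ?_
      have hc : Continuous fun z : M × ℝ => expUnit (z.2 * Complex.I) • z.1 :=
        continuous_expUnit_smul.comp (f := fun z : M × ℝ => ((z.2 : ℂ) * Complex.I, z.1))
          (by fun_prop)
      refine hc.continuousAt.eventually_mem (e.open_source.mem_nhds ?_)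
      rwa [expUnit_smul_eq_self n hp]
    filter_upwards [h2] with x hx θ
    obtain ⟨θ', hθ', h⟩ := (expUnit_smul_periodic x).exists_mem_Ico₀ Real.two_pi_pos θ
    rw [h]
    exact hx θ' ⟨hθ'.1, hθ'.2.le⟩
  have hball : ∀ᶠ v in 𝓝 (0 : Cn n),
      v ∈ e.target ∧ ∀ θ : ℝ, expUnit (θ * Complex.I) • e.symm v ∈ e.source := by
    have h0 : (0 : Cn n) ∈ e.target := hep ▸ e.map_source hpe
    have h2 : Tendsto e.symm (𝓝 0) (𝓝 p) := by
      have := e.continuousAt_symm h0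
      rwa [ContinuousAt, ← hep, e.left_inv hpe, hep] at this
    exact (e.open_target.eventually_mem h0).and (h2.eventually horbit)
  obtain ⟨r, hr, hball⟩ := Metric.eventually_nhds_iff.1 hball
  have hN : ∀ v, A.circleNorm v < r → dist v 0 < r := fun v hv => by
    rw [dist_zero_right]; exact (A.norm_le_circleNorm v).trans_lt hv
  refine ⟨⟨A, e, hbi, hpe, hep, r, hr, fun v hv => (hball (hN v hv)).1, fun v hv θ => ?_⟩, heV⟩
  obtain ⟨hvt, hvo⟩ := hball (hN v hv)
  have h2 : e (expUnit (θ * Complex.I) • e.symm v) = A (θ * Complex.I) v := by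
    rw [he_apply _ (heφ (hvo θ)), averagedChart_circle_smul hp (fun θ => heφ (hvo θ)),
      ← he_apply _ (heφ (e.map_target hvt)), e.right_inv hvt]
  rw [← h2, e.left_inv (hvo θ)]

end Linearization

namespace LinearizingChart

variable {n : ℕ} {M : Type*} [TopologicalSpace M] [ChartedSpace (Cn n) M] [MulAction ℂˣ M]
  {p : M} (L : LinearizingChart n p)

theorem chart_symm_zero : L.chart.symm 0 = p := by rw [← L.map_point, L.chart.left_inv L.mem_source]

/-- The inverse of a linearizing chart intertwines the actions of `exp t`, as long as the linear
orbit stays in the ball. -/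
theorem expUnit_smul_symm [T2Space M] [ContMDiffSMul 𝓘(ℂ, ℂ) 𝓘(ℂ, Cn n) ω ℂˣ M]
    {v : Cn n} {t : ℝ} (ht : 0 ≤ t)
    (hv : ∀ s ∈ Icc 0 t, L.flow.circleNorm (L.flow s v) < L.radius) :
    expUnit t • L.chart.symm v = L.chart.symm (L.flow t v) := by
  set A := L.flow
  set e := L.chart
  set x := e.symm v with hx
  have hc1 : Continuous fun s : ℝ => expUnit s • x :=
    (contMDiff_expUnit_smul (n := n) x).continuous.comp Complex.continuous_ofReal
  have hc2 : ContinuousOn (fun s : ℝ => e.symm (A s v)) (Icc 0 t) :=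
    e.continuousOn_symm.comp ((A.differentiable_apply v).continuous.comp
      Complex.continuous_ofReal).continuousOn fun s hs => L.mem_target _ (hv s hs)
  suffices h : Icc 0 t ⊆ {s : ℝ | expUnit s • x = e.symm (A s v)} from h ⟨ht, le_rfl⟩
  refine IsClosed.Icc_subset_of_forall_mem_nhdsWithin ?_ ?_ ?_
  · rw [inter_comm]
    exact (hc1.continuousOn.prodMk hc2).preimage_isClosed_of_isClosed isClosed_Icc
      isClosed_diagonal
  · simp [expUnit_zero, A.zero_apply, hx]
  · rintro s ⟨hs, hst⟩
    have hs : expUnit s • x = e.symm (A s v) := hs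
    have hsN := hv s ⟨hst.1, hst.2.le⟩
    have hsrc : expUnit s • x ∈ e.source := by
      rw [hs]; exact e.map_target (L.mem_target _ hsN)
    -- both curves are holomorphic, and agree on the vertical line through `s`
    have hev := eventuallyEq_of_eventually_eq_add_mul_I (ζ₀ := (s : ℂ))
      (f := fun ζ => e (expUnit ζ • x)) (g := fun ζ => A ζ v)
      (analyticAt_chart_comp (contMDiff_expUnit_smul x _) L.isBiholomorphism hsrc)
      ((A.differentiable_apply v).analyticAt _) (Eventually.of_forall fun θ => by
        rw [add_comm, expUnit_add_smul, hs, L.circle_smul_symm _ hsN, A.add_apply]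
        refine e.right_inv (L.mem_target _ ?_)
        rwa [A.circleNorm_circle_apply])
    have hsrc' : ∀ᶠ ζ in 𝓝 (s : ℂ), expUnit ζ • x ∈ e.source :=
      (contMDiff_expUnit_smul (n := n) x).continuous.continuousAt.eventually_mem
        (e.open_source.mem_nhds hsrc)
    have hreal := (Complex.continuous_ofReal.tendsto s).eventually (hev.and hsrc')
    filter_upwards [nhdsWithin_le_nhds hreal] with s' hs'
    rw [← hs'.1, e.left_inv hs'.2]

end LinearizingChart

/-! ### Gluing linearizing charts along the orbits -/

theorem PeriodicFlow.isHolomorphicLinearAction_toRepresentation {n : ℕ} (A : PeriodicFlow (Cn n)) :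
    IsHolomorphicLinearAction A.toRepresentation := by
  rintro ⟨c₀, v₀⟩
  -- a branch of the logarithm that is holomorphic near `c₀`
  have h1 : (fun q : ℂˣ × Cn n => A.toRepresentation q.1 q.2) =
      (fun z : ℂ × Cn n => A (Complex.log (z.1 / c₀) + Complex.log c₀) z.2) ∘
        fun q : ℂˣ × Cn n => ((q.1 : ℂ), q.2) := by
    funext q
    refine A.toRepresentation_apply_of_exp_eq ?_ _
    rw [Complex.exp_add, Complex.exp_log (div_ne_zero q.1.ne_zero c₀.ne_zero),
      Complex.exp_log c₀.ne_zero, div_mul_cancel₀ _ c₀.ne_zero]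
  rw [h1]
  have h2 : ContMDiffAt (𝓘(ℂ, ℂ).prod 𝓘(ℂ, Cn n)) 𝓘(ℂ, ℂ × Cn n) ω
      (fun q : ℂˣ × Cn n => ((q.1 : ℂ), q.2)) (c₀, v₀) :=
    ((Units.contMDiff_val.comp contMDiff_fst).prodMk_space contMDiff_snd) _
  refine ContMDiffAt.comp (c₀, v₀) (I' := 𝓘(ℂ, ℂ × Cn n)) ?_ h2
  refine ContDiffAt.contMDiffAt ?_
  refine ContDiffAt.clm_apply ?_ contDiffAt_snd
  refine ContDiffAt.comp (g := A) (f := fun z : ℂ × Cn n => Complex.log (z.1 / c₀) + Complex.log c₀)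
    _ A.differentiable.contDiff.contDiffAt ?_
  refine ContDiffAt.add ?_ contDiffAt_const
  refine ContDiffAt.comp (g := Complex.log) (f := fun z : ℂ × Cn n => z.1 / c₀) _
    (Complex.contDiffAt_log ?_) (contDiffAt_fst.div_const _)
  simp

section Copies

variable {k n : ℕ}

theorem Copies.contMDiff_mk (j : Fin k) :
    ContMDiff 𝓘(ℂ, Cn n) 𝓘(ℂ, Cn n) ω fun v : Cn n => (⟨j, v⟩ : Copies k n) := by
  have h := contMDiffOn_chart_symm (I := 𝓘(ℂ, Cn n)) (n := ω) (x := (⟨j, 0⟩ : Copies k n))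
  have h1 : (chartAt (Cn n) (⟨j, 0⟩ : Copies k n)).target = univ := by
    change (Copies.chart n j).target = univ
    simp [Copies.chart]
  rw [h1] at h
  exact contMDiffOn_univ.1 h

theorem Copies.contMDiff_snd :
    ContMDiff 𝓘(ℂ, Cn n) 𝓘(ℂ, Cn n) ω fun q : Copies k n => q.2 := by
  rintro ⟨j, v⟩
  have h := contMDiffOn_chart (I := 𝓘(ℂ, Cn n)) (n := ω) (x := (⟨j, 0⟩ : Copies k n))
  have h1 : (chartAt (Cn n) (⟨j, 0⟩ : Copies k n)).source = range (Sigma.mk j) := by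
    change (Copies.chart n j).source = _
    simp [Copies.chart]
  rw [h1] at h
  have h2 : range (Sigma.mk j) ∈ 𝓝 (⟨j, v⟩ : Copies k n) :=
    isOpen_range_sigmaMk.mem_nhds ⟨v, rfl⟩
  refine ((h _ ⟨v, rfl⟩).contMDiffAt h2).congr_of_eventuallyEq ?_
  filter_upwards [h2] with q hq
  obtain ⟨w, rfl⟩ := hq
  exact ((Copies.chart n j).right_inv (x := w) (by simp [Copies.chart])).symm

end Copies

section Gluing

variable {n k : ℕ} {M : Type*} [TopologicalSpace M] [ChartedSpace (Cn n) M]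
  [MulAction ℂˣ M] [ContMDiffSMul 𝓘(ℂ, ℂ) 𝓘(ℂ, Cn n) ω ℂˣ M]

/-- Let `e j` be charts centred at the `p j`, with inverses defined on the sets `D j`. If an element
of `ℂˣ` moves a point of one `D i` to a point of another `D j` in the linear model exactly when it
does so in `M`, then the charts extend to an equivariant biholomorphism from the union of the orbits
that meet some `(e j).symm '' D j` to the union of the linear orbits that meet some `D j`. -/
theorem exists_equivariant_biholomorphism (hk : 1 ≤ k) (p : Fin k → M)
    (ρ : Fin k → Representation ℂ ℂˣ (Cn n)) (e : Fin k → OpenPartialHomeomorph M (Cn n))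
    (he : ∀ j, IsBiholomorphism (n := n) (e j)) (hp : ∀ j, p j ∈ (e j).source)
    (hep : ∀ j, e j (p j) = 0) (D : Fin k → Set (Cn n)) (hD : ∀ j, IsOpen (D j))
    (hDe : ∀ j, D j ⊆ (e j).target) (hD0 : ∀ j, 0 ∈ D j)
    (hrel : ∀ i j, ∀ v ∈ D i, ∀ w ∈ D j, ∀ c : ℂˣ,
      c • (e i).symm v = (e j).symm w ↔ i = j ∧ ρ i c v = w) :
    ∃ Φ : OpenPartialHomeomorph M (Copies k n),
      IsBiholomorphism (n := n) Φ ∧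
      (∀ j, p j ∈ Φ.source) ∧
      (∀ (c : ℂˣ), ∀ x ∈ Φ.source, c • x ∈ Φ.source) ∧
      (∀ j, (⟨j, 0⟩ : Copies k n) ∈ Φ.target) ∧
      (∀ j, Φ (p j) = ⟨j, 0⟩) ∧
      (∀ (c : ℂˣ), ∀ x ∈ Φ.source, Φ (c • x) = ⟨(Φ x).1, ρ (Φ x).1 c (Φ x).2⟩) := by
  classical
  let j₀ : Fin k := ⟨0, hk⟩
  have hsmul : ∀ c : ℂˣ, ContMDiff 𝓘(ℂ, Cn n) 𝓘(ℂ, Cn n) ω fun x : M => c • x := fun c =>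
    ContMDiffSMul.contMDiff_const_smul (I := 𝓘(ℂ, ℂ)) c
  have hρinv : ∀ (j : Fin k) (c : ℂˣ) (v : Cn n), ρ j c (ρ j c⁻¹ v) = v := fun j c v => by
    rw [← Module.End.mul_apply, ← map_mul, mul_inv_cancel, map_one, Module.End.one_apply]
  have hρinv' : ∀ (j : Fin k) (c : ℂˣ) (v : Cn n), ρ j c⁻¹ (ρ j c v) = v := fun j c v => by
    rw [← Module.End.mul_apply, ← map_mul, inv_mul_cancel, map_one, Module.End.one_apply]
  have hρmul : ∀ (j : Fin k) (c d : ℂˣ) (v : Cn n), ρ j (c * d) v = ρ j c (ρ j d v) :=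
    fun j c d v => by rw [map_mul, Module.End.mul_apply]
  have hρdiff : ∀ (j : Fin k) (c : ℂˣ), ContMDiff 𝓘(ℂ, Cn n) 𝓘(ℂ, Cn n) ω (ρ j c) := fun j c =>
    (LinearMap.toContinuousLinearMap (ρ j c)).contDiff.contMDiff
  -- the open sets, and the two maps between them
  let U : Set M := {x | ∃ (c : ℂˣ) (j : Fin k), ∃ v ∈ D j, c • x = (e j).symm v}
  let W : Set (Copies k n) := {q | ∃ c : ℂˣ, ρ q.1 c q.2 ∈ D q.1}
  -- if `c • x = (e j).symm v` with `v ∈ D j`, then `x` must go to `ρ j c⁻¹ v` in the `j`-th copy;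
  -- by `hrel` this does not depend on the choices
  have hex : ∀ x : M, ∃ q : Copies k n, ∀ (c : ℂˣ) (j : Fin k), ∀ v ∈ D j,
      c • x = (e j).symm v → q = ⟨j, ρ j c⁻¹ v⟩ := by
    intro x
    by_cases hx : x ∈ U
    · obtain ⟨c', j', v', hv', hx'⟩ := hx
      refine ⟨⟨j', ρ j' c'⁻¹ v'⟩, fun c j v hv hc => ?_⟩
      have h1 : (c * c'⁻¹) • (e j').symm v' = (e j).symm v := by
        rw [← hx', mul_smul, inv_smul_smul, hc]
      obtain ⟨rfl, h2⟩ := (hrel _ _ _ hv' _ hv _).1 h1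
      rw [← h2, hρmul, hρinv']
    · exact ⟨⟨j₀, 0⟩, fun c j v hv hc => absurd ⟨c, j, v, hv, hc⟩ hx⟩
  choose Φ hΦ using hex
  have hex' : ∀ q : Copies k n, ∃ x : M, ∀ c : ℂˣ, ρ q.1 c q.2 ∈ D q.1 →
      x = c⁻¹ • (e q.1).symm (ρ q.1 c q.2) := by
    rintro ⟨j, v⟩
    by_cases hq : (⟨j, v⟩ : Copies k n) ∈ W
    · obtain ⟨c', hc'⟩ := hq
      refine ⟨c'⁻¹ • (e j).symm (ρ j c' v), fun c hc => ?_⟩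
      have h1 : (c * c'⁻¹) • (e j).symm (ρ j c' v) = (e j).symm (ρ j c v) :=
        (hrel _ _ _ hc' _ hc _).2 ⟨rfl, by rw [hρmul, hρinv']⟩
      change c'⁻¹ • (e j).symm (ρ j c' v) = c⁻¹ • (e j).symm (ρ j c v)
      rw [← h1, mul_smul, inv_smul_smul]
    · exact ⟨p j₀, fun c hc => absurd ⟨c, hc⟩ hq⟩
  choose Γ hΓ using hex'
  have hUc : ∀ (c : ℂˣ) (j : Fin k), IsOpen {x : M | c • x ∈ (e j).symm '' D j} := fun c j =>
    ((e j).isOpen_image_symm_of_subset_target (hD j) (hDe j)).preimage (hsmul c).continuous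
  have hWc : ∀ c : ℂˣ, IsOpen {q : Copies k n | ρ q.1 c q.2 ∈ D q.1} := fun c =>
    isOpen_sigma_iff.2 fun j => (hD j).preimage (hρdiff j c).continuous
  have hU : IsOpen U := by
    rw [isOpen_iff_mem_nhds]
    rintro x ⟨c, j, v, hv, hx⟩
    filter_upwards [(hUc c j).mem_nhds ⟨v, hv, hx.symm⟩] with x' hx'
    obtain ⟨v', hv', h⟩ := hx'
    exact ⟨c, j, v', hv', h.symm⟩
  have hW : IsOpen W := by
    rw [isOpen_iff_mem_nhds]
    rintro q ⟨c, hc⟩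
    filter_upwards [(hWc c).mem_nhds hc] with q' hq'
    exact ⟨c, hq'⟩
  have hΦdiff : ContMDiffOn 𝓘(ℂ, Cn n) 𝓘(ℂ, Cn n) ω Φ U := by
    rintro x ⟨c, j, v, hv, hx⟩
    have hsrc : c • x ∈ (e j).source := by rw [hx]; exact (e j).map_target (hDe j hv)
    have h1 : ContMDiffAt 𝓘(ℂ, Cn n) 𝓘(ℂ, Cn n) ω
        (fun x' => (⟨j, ρ j c⁻¹ (e j (c • x'))⟩ : Copies k n)) x := by
      refine (Copies.contMDiff_mk j).contMDiffAt.comp x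
        ((hρdiff j c⁻¹).contMDiffAt.comp x ?_)
      exact (((he j).holomorphic _ hsrc).contMDiffAt ((e j).open_source.mem_nhds hsrc)).comp x
        (hsmul c).contMDiffAt
    refine (h1.congr_of_eventuallyEq ?_).contMDiffWithinAt
    filter_upwards [(hUc c j).mem_nhds ⟨v, hv, hx.symm⟩] with x' hx'
    obtain ⟨v', hv', h⟩ := hx'
    rw [hΦ x' c j v' hv' h.symm, ← h, (e j).right_inv (hDe j hv')]
  have hΓdiff : ContMDiffOn 𝓘(ℂ, Cn n) 𝓘(ℂ, Cn n) ω Γ W := by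
    rintro ⟨j, v⟩ ⟨c, hc⟩
    have hc : ρ j c v ∈ D j := hc
    have h1 : ContMDiffAt 𝓘(ℂ, Cn n) 𝓘(ℂ, Cn n) ω
        (fun q : Copies k n => c⁻¹ • (e j).symm (ρ j c q.2)) ⟨j, v⟩ := by
      refine (hsmul c⁻¹).contMDiffAt.comp _ ?_
      refine ContMDiffAt.comp (g := (e j).symm) (f := fun q : Copies k n => ρ j c q.2) _
        (((he j).holomorphic_symm _ (hDe j hc)).contMDiffAt
          ((e j).open_target.mem_nhds (hDe j hc))) ?_
      exact (hρdiff j c).contMDiffAt.comp _ Copies.contMDiff_snd.contMDiffAt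
    refine (h1.congr_of_eventuallyEq ?_).contMDiffWithinAt
    filter_upwards [(hWc c).mem_nhds hc, isOpen_range_sigmaMk.mem_nhds ⟨v, rfl⟩] with q hq hqj
    obtain ⟨w, rfl⟩ := hqj
    exact hΓ _ c hq
  let Φ' : OpenPartialHomeomorph M (Copies k n) :=
    { toFun := Φ
      invFun := Γ
      source := U
      target := W
      map_source' := by
        rintro x ⟨c, j, v, hv, hx⟩
        rw [hΦ x c j v hv hx]
        exact ⟨c, by rwa [hρinv]⟩
      map_target' := by
        rintro q ⟨c, hc⟩
        exact ⟨c, q.1, _, hc, by rw [hΓ q c hc, smul_inv_smul]⟩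
      left_inv' := by
        rintro x ⟨c, j, v, hv, hx⟩
        rw [hΦ x c j v hv hx, hΓ _ c (by rwa [hρinv])]
        simp only [hρinv]
        rw [← hx, inv_smul_smul]
      right_inv' := by
        rintro q ⟨c, hc⟩
        rw [hΦ (Γ q) c q.1 _ hc (by rw [hΓ q c hc, smul_inv_smul]), hρinv']
      open_source := hU
      open_target := hW
      continuousOn_toFun := hΦdiff.continuousOn
      continuousOn_invFun := hΓdiff.continuousOn }
  have hp1 : ∀ j, (1 : ℂˣ) • p j = (e j).symm 0 := fun j => by
    rw [one_smul, ← hep j, (e j).left_inv (hp j)]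
  refine ⟨Φ', ⟨hΦdiff, hΓdiff⟩, fun j => ⟨1, j, 0, hD0 j, hp1 j⟩, ?_, ?_, ?_, ?_⟩
  · rintro c x ⟨c', j, v, hv, hx⟩
    exact ⟨c' * c⁻¹, j, v, hv, by rw [mul_smul, inv_smul_smul, hx]⟩
  · exact fun j => ⟨1, by rw [map_zero]; exact hD0 j⟩
  · intro j
    change Φ (p j) = _
    rw [hΦ _ 1 j 0 (hD0 j) (hp1 j), map_zero]
  · rintro c x ⟨c', j, v, hv, hx⟩
    change Φ (c • x) = ⟨(Φ x).1, ρ (Φ x).1 c (Φ x).2⟩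
    rw [hΦ (c • x) (c' * c⁻¹) j v hv (by rw [mul_smul, inv_smul_smul, hx]), hΦ x c' j v hv hx,
      mul_inv_rev, inv_inv, hρmul]

end Gluing

/-! ### Separation of orbits by the moment map -/

section Separation

variable {n : ℕ} {M : Type*} [TopologicalSpace M] [ChartedSpace (Cn n) M]
  [MulAction ℂˣ M] [ContMDiffSMul 𝓘(ℂ, ℂ) 𝓘(ℂ, Cn n) ω ℂˣ M]

/-- On orbits that start close to a fixed point of level `0`, the moment map exceeds a positive
constant when they leave a ball of the linearizing chart. -/
theorem LinearizingChart.exists_lt_momentMap_at_exit [T2Space M] {p : M}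
    (L : LinearizingChart n p)
    {Ω : TwoForm n M} (htame : Ω.IsTamedByAction) {Ψ : M → ℝ} (hΨ : Ω.IsMomentMap Ψ)
    (hp : Ψ p = 0) {δ : ℝ} (hδ : 0 < δ) (hδr : δ < L.radius) :
    ∃ η > 0, ∃ c > 0, ∀ v, L.flow.circleNorm v < η → ∀ t : ℝ, 0 ≤ t →
      (∀ s ∈ Icc 0 t, L.flow.circleNorm (L.flow s v) ≤ δ) →
      L.flow.circleNorm (L.flow t v) = δ → c < Ψ (L.chart.symm (L.flow t v)) := by
  refine L.flow.exists_lt_at_exit hδ (u := fun v => Ψ (L.chart.symm v)) ?_ ?_ ?_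
  · exact hΨ.smooth.continuous.comp_continuousOn (L.chart.continuousOn_symm.mono
      fun v hv => L.mem_target v (lt_of_le_of_lt hv hδr))
  · rw [L.chart_symm_zero, hp]
  · rintro v ⟨ζ, hζ⟩ t ht hstay
    have hv : L.flow.circleNorm v < L.radius := by
      have := hstay 0 ⟨le_rfl, ht.le⟩
      rw [Complex.ofReal_zero, L.flow.zero_apply] at this
      exact this.trans_lt hδr
    have hfix : L.chart.symm v ∉ circleFixedPoints M := by
      intro hmem
      refine hζ (L.flow.apply_eq_self_of_circle (fun θ => ?_) ζ)
      have h1 := L.circle_smul_symm v hv θ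
      rw [expUnit_mul_I_smul_of_mem hmem] at h1
      refine L.chart.symm.injOn (L.mem_target _ ?_) (L.mem_target _ hv) h1.symm
      rwa [L.flow.circleNorm_circle_apply]
    have h1 := strictMono_momentMap htame hΨ hfix ht
    simp only [Complex.ofReal_zero, expUnit_zero, one_smul] at h1
    rwa [L.expUnit_smul_symm ht.le fun s hs => (hstay s hs).trans_lt hδr] at h1

variable [IsManifold 𝓘(ℂ, Cn n) ω M]

theorem monotone_momentMap {Ω : TwoForm n M} (htame : Ω.IsTamedByAction) {Ψ : M → ℝ}
    (hΨ : Ω.IsMomentMap Ψ) (x : M) :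
    Monotone fun t : ℝ => Ψ (expUnit t • x) := by
  by_cases hx : x ∈ circleFixedPoints M
  · simp only [expUnit_smul_eq_self n hx]
    exact monotone_const
  · exact (strictMono_momentMap htame hΨ hx).monotone

/-- On small invariant balls around the `p j`, the orbit relation of `M` is that of the linear
models. A linear orbit segment between two points of a ball stays in a larger ball, by
`PeriodicFlow.circleNorm_apply_le_max`, so the same relation holds in `M`. Conversely, consider an
orbit segment in `M` that starts in the `i`-th ball, and choose its orientation such that the moment
map increases. If the segment leaves a larger ball of the `i`-th chart, the moment map then exceeds
the value `c i`, and it stays below that value in all the small balls; so the segment does not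
leave, and ends in the `i`-th ball at the point that the linear flow predicts. -/
theorem exists_smul_symm_eq_iff [T2Space M] {k : ℕ} {p : Fin k → M}
    (L : ∀ j, LinearizingChart n (p j))
    (hdisj : Pairwise fun i j => Disjoint (L i).chart.source (L j).chart.source)
    {Ω : TwoForm n M} (htame : Ω.IsTamedByAction) {Ψ : M → ℝ} (hΨ : Ω.IsMomentMap Ψ)
    (hp : ∀ j, Ψ (p j) = 0) :
    ∃ ε : Fin k → ℝ, (∀ j, 0 < ε j ∧ ε j ≤ (L j).radius) ∧
      ∀ i j v w, (L i).flow.circleNorm v < ε i → (L j).flow.circleNorm w < ε j → ∀ c : ℂˣ,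
        c • (L i).chart.symm v = (L j).chart.symm w ↔
          i = j ∧ (L i).flow.toRepresentation c v = w := by
  have hδ : ∀ j, 0 < (L j).radius / 2 := fun j => half_pos (L j).radius_pos
  have hδr : ∀ j, (L j).radius / 2 < (L j).radius := fun j => half_lt_self (L j).radius_pos
  choose η hη c hc hexit using fun j =>
    (L j).exists_lt_momentMap_at_exit htame hΨ (hp j) (hδ j) (hδr j)
  -- near the `p j`, the moment map stays below all the exit values
  have hsmall : ∀ j, ∃ κ > 0, ∀ w, (L j).flow.circleNorm w < κ →
      ∀ i, Ψ ((L j).chart.symm w) < c i := by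
    intro j
    have h0 : (0 : Cn n) ∈ (L j).chart.target :=
      (L j).map_point ▸ (L j).chart.map_source (L j).mem_source
    have hcont : ContinuousAt (fun w => Ψ ((L j).chart.symm w)) 0 :=
      hΨ.smooth.continuous.continuousAt.comp ((L j).chart.continuousAt_symm h0)
    have hev : ∀ᶠ w in 𝓝 (0 : Cn n), ∀ i, Ψ ((L j).chart.symm w) < c i :=
      eventually_all.2 fun i => hcont.eventually_lt_const (by
        beta_reduce
        rw [(L j).chart_symm_zero, hp]
        exact hc i)
    obtain ⟨κ, hκ, h⟩ := Metric.eventually_nhds_iff.1 hev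
    refine ⟨κ, hκ, fun w hw => h ?_⟩
    rw [dist_zero_right]
    exact ((L j).flow.norm_le_circleNorm w).trans_lt hw
  choose κ hκ hκc using hsmall
  set ε : Fin k → ℝ := fun j => min ((L j).radius / 2) (min (η j) (κ j)) with hε
  have hεδ : ∀ j, ε j ≤ (L j).radius / 2 := fun j => min_le_left _ _
  have hεη : ∀ j, ε j ≤ η j := fun j => (min_le_right _ _).trans (min_le_left _ _)
  have hεκ : ∀ j, ε j ≤ κ j := fun j => (min_le_right _ _).trans (min_le_right _ _)
  refine ⟨ε, fun j => ⟨lt_min (hδ j) (lt_min (hη j) (hκ j)), (hεδ j).trans (hδr j).le⟩, ?_⟩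
  have hmem : ∀ j v, (L j).flow.circleNorm v < (L j).radius / 2 → v ∈ (L j).chart.target :=
    fun j v hv => (L j).mem_target v (hv.trans (hδr j))
  have hinj : ∀ i j v w, v ∈ (L i).chart.target → w ∈ (L j).chart.target →
      (L i).chart.symm v = (L j).chart.symm w → i = j ∧ v = w := by
    intro i j v w hv hw h
    have hij : i = j := by
      by_contra hij
      exact disjoint_left.1 (hdisj hij) ((L i).chart.map_target hv)
        (h ▸ (L j).chart.map_target hw)
    subst hij
    exact ⟨rfl, (L i).chart.symm.injOn hv hw h⟩
  -- the forward direction for positive real times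
  have key : ∀ i j v w (t : ℝ), 0 ≤ t → (L i).flow.circleNorm v < ε i →
      (L j).flow.circleNorm w < ε j → expUnit t • (L i).chart.symm v = (L j).chart.symm w →
      i = j ∧ (L i).flow t v = w := by
    intro i j v w t ht hv hw h
    by_cases hin : ∀ s ∈ Icc 0 t, (L i).flow.circleNorm ((L i).flow s v) < (L i).radius / 2
    · rw [(L i).expUnit_smul_symm ht fun s hs => (hin s hs).trans (hδr i)] at h
      exact hinj i j _ _ (hmem i _ (hin t ⟨ht, le_rfl⟩)) (hmem j _ (hw.trans_le (hεδ j))) h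
    · exfalso
      obtain ⟨s, hs, hstay, heq⟩ := (L i).flow.exists_first_exit (hv.trans_le (hεδ i)) hin
      have h1 := hexit i v (hv.trans_le (hεη i)) s hs.1 hstay heq
      rw [← (L i).expUnit_smul_symm hs.1 fun s' hs' => (hstay s' hs').trans_lt (hδr i)] at h1
      have h2 : Ψ (expUnit s • (L i).chart.symm v) ≤ Ψ (expUnit t • (L i).chart.symm v) :=
        monotone_momentMap htame hΨ _ hs.2
      rw [h] at h2
      linarith [hκc j w (hw.trans_le (hεκ j)) i]
  have hback : ∀ i v w (t : ℝ), 0 ≤ t → (L i).flow.circleNorm v < ε i →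
      (L i).flow.circleNorm w < ε i → (L i).flow t v = w →
      expUnit t • (L i).chart.symm v = (L i).chart.symm w := by
    rintro i v _ t ht hv hw rfl
    refine (L i).expUnit_smul_symm ht fun s hs => ?_
    refine ((L i).flow.circleNorm_apply_le_max hs.1 hs.2 v).trans_lt ?_
    exact (max_lt hv hw).trans_le ((hεδ i).trans (hδr i).le)
  have hreal : ∀ i j v w (t : ℝ), (L i).flow.circleNorm v < ε i →
      (L j).flow.circleNorm w < ε j →
      (expUnit t • (L i).chart.symm v = (L j).chart.symm w ↔ i = j ∧ (L i).flow t v = w) := by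
    intro i j v w t hv hw
    rcases le_total 0 t with ht | ht
    · refine ⟨key i j v w t ht hv hw, ?_⟩
      rintro ⟨rfl, h⟩
      exact hback i v w t ht hv hw h
    · have ht' : 0 ≤ -t := by linarith
      constructor
      · intro h
        have h1 : expUnit (-t : ℝ) • (L j).chart.symm w = (L i).chart.symm v := by
          rw [← h, ← expUnit_add_smul, Complex.ofReal_neg, neg_add_cancel, expUnit_zero, one_smul]
        obtain ⟨rfl, h2⟩ := key j i w v (-t) ht' hw hv h1
        refine ⟨rfl, ?_⟩
        rw [← h2, Complex.ofReal_neg, (L j).flow.apply_neg_apply]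
      · rintro ⟨rfl, h⟩
        have h1 := hback i w v (-t) ht' hw hv (by
          rw [← h, Complex.ofReal_neg, (L i).flow.neg_apply_apply])
        rw [← h1, ← expUnit_add_smul, Complex.ofReal_neg, add_neg_cancel, expUnit_zero, one_smul]
  intro i j v w hv hw a
  set ζ := Complex.log a with hζ
  -- split off the rotation, which is moved to the right-hand side
  have hsplit : (ζ.im : ℂ) * Complex.I + (ζ.re : ℂ) = ζ := by rw [add_comm, Complex.re_add_im]
  have hact : a • (L i).chart.symm v =
      expUnit ((ζ.im : ℂ) * Complex.I) • expUnit (ζ.re : ℂ) • (L i).chart.symm v := by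
    rw [← expUnit_add_smul, hsplit, hζ, expUnit_log]
  have hrep : (L i).flow.toRepresentation a v =
      (L i).flow ((ζ.im : ℂ) * Complex.I) ((L i).flow (ζ.re : ℂ) v) := by
    rw [← (L i).flow.add_apply, hsplit]
    rfl
  have hw' : (L j).flow.circleNorm ((L j).flow ((-ζ.im : ℝ) * Complex.I) w) < ε j := by
    rwa [(L j).flow.circleNorm_circle_apply]
  have h1 := hreal i j v _ ζ.re hv hw'
  rw [← (L j).circle_smul_symm w (hw.trans_le ((hεδ j).trans (hδr j).le))] at h1
  have hneg : ((-ζ.im : ℝ) : ℂ) * Complex.I = -((ζ.im : ℂ) * Complex.I) := by push_cast; ring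
  rw [hneg] at h1
  have h2 : expUnit ((ζ.im : ℂ) * Complex.I) • expUnit (ζ.re : ℂ) • (L i).chart.symm v =
      (L j).chart.symm w ↔ expUnit (ζ.re : ℂ) • (L i).chart.symm v =
      expUnit (-((ζ.im : ℂ) * Complex.I)) • (L j).chart.symm w := by
    constructor
    · intro h
      rw [← h, ← expUnit_add_smul, neg_add_cancel, expUnit_zero, one_smul]
    · intro h
      rw [h, ← expUnit_add_smul, add_neg_cancel, expUnit_zero, one_smul]
  rw [hact, hrep, h2, h1]
  refine and_congr_right ?_
  rintro rfl
  constructor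
  · intro h
    rw [h, (L i).flow.apply_neg_apply]
  · intro h
    rw [← h, (L i).flow.neg_apply_apply]

end Separation

end TameCircle

end

open TameCircle in
theorem proposition2p1 {n : ℕ} {M : Type*} [TopologicalSpace M] [T2Space M]
    [ChartedSpace (Cn n) M] [IsManifold 𝓘(ℂ, Cn n) ω M]
    [MulAction ℂˣ M] [ContMDiffSMul 𝓘(ℂ, ℂ) 𝓘(ℂ, Cn n) ω ℂˣ M]
    (Ω : TwoForm n M) (hΩ : Ω.IsSymplectic) (hΩinv : Ω.IsCircleInvariant)
    (htame : Ω.IsTamedByAction) (Ψ : M → ℝ) (hΨ : Ω.IsMomentMap Ψ)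
    {k : ℕ} (hk : 1 ≤ k) (p : Fin k → M) (hp : Function.Injective p)
    (hpfix : ∀ j, p j ∈ circleFixedPoints M) (hpzero : ∀ j, Ψ (p j) = 0) :
    ∃ (ρ : Fin k → Representation ℂ ℂˣ (Cn n)) (Φ : OpenPartialHomeomorph M (Copies k n)),
      (∀ j, IsHolomorphicLinearAction (ρ j)) ∧
      IsBiholomorphism (n := n) Φ ∧
      (∀ j, p j ∈ Φ.source) ∧
      (∀ (c : ℂˣ), ∀ x ∈ Φ.source, c • x ∈ Φ.source) ∧
      (∀ j, (⟨j, 0⟩ : Copies k n) ∈ Φ.target) ∧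
      (∀ j, Φ (p j) = ⟨j, 0⟩) ∧
      (∀ (c : ℂˣ), ∀ x ∈ Φ.source, Φ (c • x) = ⟨(Φ x).1, ρ (Φ x).1 c (Φ x).2⟩) := by
  obtain ⟨V, hV, hVdisj⟩ := (Set.finite_range p).t2_separation
  choose L hL using fun j =>
    exists_linearizingChart (n := n) (hpfix j) (hV (p j)).2 (hV (p j)).1
  have hdisj : Pairwise fun i j => Disjoint (L i).chart.source (L j).chart.source :=
    fun i j hij => (hVdisj ⟨i, rfl⟩ ⟨j, rfl⟩ (hp.ne hij)).mono (hL i) (hL j)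
  obtain ⟨ε, hε, hrel⟩ := exists_smul_symm_eq_iff L hdisj htame hΨ hpzero
  obtain ⟨Φ, hΦ⟩ := exists_equivariant_biholomorphism hk p
    (fun j => (L j).flow.toRepresentation) (fun j => (L j).chart)
    (fun j => (L j).isBiholomorphism) (fun j => (L j).mem_source) (fun j => (L j).map_point)
    (fun j => {v | (L j).flow.circleNorm v < ε j})
    (fun j => isOpen_lt (L j).flow.continuous_circleNorm continuous_const)
    (fun j v hv => (L j).mem_target v (lt_of_lt_of_le hv (hε j).2))
    (fun j => by
      change (L j).flow.circleNorm 0 < ε j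
      rw [(L j).flow.circleNorm_zero]
      exact (hε j).1)
    (fun i j v hv w hw c => hrel i j v w hv hw c)
  exact ⟨_, Φ, fun j => (L j).flow.isHolomorphicLinearAction_toRepresentation, hΦ⟩
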